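/- Let $k,r,\lambda$ be integers with $k>r>\lambda\ge 0$, and let $\eta\geq 1$ and $\alpha_1,\dots,\alpha_\lambda$ be integers with $0<\alpha_1<\cdots<\alpha_\lambda<\eta$ and $\alpha_i=\eta-\alpha_{\lambda+1-i}$ for $1\le i\le\lambda$. Let $q$ be a complex number with $0<|q|<1$. Write $(a;q)_\infty=\prod_{i\ge 0}(1-aq^i)$, $(a_1,\dots,a_m;q)_\infty=(a_1;q)_\infty\cdots(a_m;q)_\infty$, and $(a;q)_n=(a;q)_\infty/(aq^n;q)_\infty$ for every integer $n$. Then $$\sum_{N_1\ge\cdots\ge N_{k-1}\ge 0}\frac{q^{\eta(N_1^2+\cdots+N_{k-1}^2+N_r+\cdots+N_{k-1})}\,(1+q^{-\eta N_r})\,(-q^{\eta-\eta N_{\lambda+1}};q^\eta)_{N_{\lambda+1}-1}\,(-q^{\eta+\eta N_\lambda};q^\eta)_\infty}{(q^\eta;q^\eta)_{N_1-N_2}\cdots(q^\eta;q^\eta)_{N_{k-2}-N_{k-1}}\,(q^{2\eta};q^{2\eta})_{N_{k-1}}}$$ $$\times\prod_{s=1}^{\lambda}(-q^{\eta-\alpha_s-\eta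 N_s};q^\eta)_{N_s}\prod_{s=2}^{\lambda}(-q^{\eta-\alpha_s+\eta N_{s-1}};q^\eta)_\infty$$ $$=\frac{(-q^{\alpha_1},\dots,-q^{\alpha_\lambda},-q^\eta;q^\eta)_\infty\,\bigl(q^{(r-\frac{\lambda}{2})\eta},q^{(2k-r-\frac{\lambda}{2}-1)\eta},q^{(2k-\lambda-1)\eta};q^{(2k-\lambda-1)\eta}\bigr)_\infty}{(q^\eta;q^\eta)_\infty},$$ where the multisum, over integers $N_1,\dots,N_{k-1}$, converges absolutely, and for $\lambda=0$ the factor $(-q^{\eta+\eta N_\lambda};q^\eta)_\infty$ is read as $1$. -/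

import Mathlib

namespace OverBressoud

/-- The infinite product `(a; q)_∞ = ∏_{i ≥ 0} (1 - a q^i)`; it is used for `‖q‖ < 1` only,
where it converges. -/
noncomputable def qInf (a q : ℂ) : ℂ := ∏' i : ℕ, (1 - a * q ^ i)

/-- `(a; q)_n = (a; q)_∞ / (a q^n; q)_∞`, for every integer `n`. The index `n = -1` does occur
below: `(-q; q)_{-1} = (-q; q)_∞ / (-1; q)_∞ = 1 / 2`. -/
noncomputable def qFin (a q : ℂ) (n : ℤ) : ℂ := qInf a q / qInf (a * q ^ n) q

/-- The index set of the multisum: all `N_1 ≥ N_2 ≥ ⋯ ≥ N_m ≥ 0`. -/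
abbrev Chain (m : ℕ) : Type := {N : Fin m → ℕ // Antitone N}

/-- The entry `N_s` of a chain, where `s` is counted from `1` (value `0` outside `1 ≤ s ≤ m`). -/
def Chain.part {m : ℕ} (N : Chain m) (s : ℕ) : ℤ :=
  if h : 1 ≤ s ∧ s ≤ m then (N.1 ⟨s - 1, by omega⟩ : ℤ) else 0

/-- The general term of the multisum, as a function of `N = (N_1, …, N_{k-1})`. For
`lam = 0` there is no `N_0`, and the factor `(-q^{η + η N_lam}; q^η)_∞` is absent. -/
noncomputable def term (k r lam : ℕ) (η : ℤ) (α : ℕ → ℤ) (q : ℂ) (N : Chain (k - 1)) : ℂ :=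
  q ^ (η * (∑ i ∈ Finset.Icc 1 (k - 1), N.part i ^ 2 + ∑ i ∈ Finset.Icc r (k - 1), N.part i))
    * (1 + q ^ (-(η * N.part r)))
    * qFin (-q ^ (η - η * N.part (lam + 1))) (q ^ η) (N.part (lam + 1) - 1)
    * (if lam = 0 then 1 else qInf (-q ^ (η + η * N.part lam)) (q ^ η))
    / ((∏ i ∈ Finset.Icc 1 (k - 2), qFin (q ^ η) (q ^ η) (N.part i - N.part (i + 1)))
        * qFin (q ^ (2 * η)) (q ^ (2 * η)) (N.part (k - 1)))
    * (∏ s ∈ Finset.Icc 1 lam, qFin (-q ^ (η - α s - η * N.part s)) (q ^ η) (N.part s))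
    * (∏ s ∈ Finset.Icc 2 lam, qInf (-q ^ (η - α s + η * N.part (s - 1))) (q ^ η))

/-- The product side. The exponents `(r - lam / 2) η` and `(2k - r - lam / 2 - 1) η` are written
as `(2r - lam) η / 2` and `(4k - 2r - lam - 2) η / 2`. -/
noncomputable def productSide (k r lam : ℕ) (η : ℤ) (α : ℕ → ℤ) (q : ℂ) : ℂ :=
  (∏ s ∈ Finset.Icc 1 lam, qInf (-q ^ α s) (q ^ η)) * qInf (-q ^ η) (q ^ η)
    * (qInf (q ^ ((2 * r - lam) * η / 2)) (q ^ ((2 * k - lam - 1) * η))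
      * qInf (q ^ ((4 * k - 2 * r - lam - 2) * η / 2)) (q ^ ((2 * k - lam - 1) * η))
      * qInf (q ^ ((2 * k - lam - 1) * η)) (q ^ ((2 * k - lam - 1) * η)))
    / qInf (q ^ η) (q ^ η)

/-- The symmetry of the `α`'s makes `lam * η` even, so both divisions by two in `productSide`
are exact. -/
theorem two_dvd_exponents (k r lam : ℕ) (η : ℤ) (α : ℕ → ℤ)
    (hsymm : ∀ i ∈ Set.Icc 1 lam, α i = η - α (lam + 1 - i)) :
    2 ∣ (2 * r - lam) * η ∧ 2 ∣ (4 * k - 2 * r - lam - 2) * η := by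
  have key : (2 : ℤ) ∣ lam * η := by
    rcases Nat.even_or_odd' lam with ⟨m, hm | hm⟩
    · exact ⟨m * η, by rw [hm]; push_cast; ring⟩
    · have h := hsymm (m + 1) ⟨by omega, by omega⟩
      have e : lam + 1 - (m + 1) = m + 1 := by omega
      rw [e] at h
      exact ⟨lam * α (m + 1), by rw [show η = 2 * α (m + 1) by omega]; ring⟩
  obtain ⟨c, hc⟩ := key
  exact ⟨⟨r * η - c, by linear_combination -hc⟩,
    ⟨2 * k * η - r * η - η - c, by linear_combination -hc⟩⟩

end OverBressoud

open Filter Topology Finset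

namespace OverBressoud

/-! ### Infinite q-products -/

variable {q : ℂ}

/-! The multisum is an iterated Bailey chain in two-sided form. For e = 0 or 1, a sequence A on ℤ
yields β_n = ∑_j A_j / ((q)_{n-j} (q)_{n+e+j}). The Bailey lemma with one parameter 1/z and the
other sent to infinity (both, if z = 0) says that a weighted sum of the β_s over s ≤ n is the β_n of
A times an explicit function of j (`baileyKernel_step`, from q-Chu–Vandermonde). Thus each summation
index N_p costs one factor on A.

Write Q = q^η for the base and read the indices from the innermost outwards. The start is e = 1, A_j
= (-1)^j Q^(j²), β_n = 1/(Q²;Q²)_n (`beta_sq`). Indices p > r use z = 0. At p = r the factor 1 +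
Q^(N_r) changes e from 1 to 0 (`one_add_mul_beta`). From there on, p > lam + 1 uses z = 0, p = lam +
1 uses z = -1, and p ≤ lam uses z = -q^(-α_p).

As N_1 is unbounded, n → ∞ in the last step, and the multisum equals ∑_j A_j / (Q)_∞
(`hasSum_stepKernel`). The symmetry of the α's makes the infinite products collected by A
independent of j (`prod_gain`), so A is a constant times a theta term, and the Jacobi triple product
(`hasSum_thetaTerm`) concludes. Convergence follows from domination by a product of one-variable
series (`hasSum_chain`). -/

theorem multipliable_qInf (hq : ‖q‖ < 1) (a : ℂ) : Multipliable fun i : ℕ => 1 - a * q ^ i := by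
  have h : Summable fun i : ℕ => ‖-(a * q ^ i)‖ := by
    simp only [norm_neg, norm_mul, norm_pow]
    exact (summable_geometric_of_lt_one (norm_nonneg _) hq).mul_left _
  simpa [sub_eq_add_neg] using multipliable_one_add_of_summable h

theorem qInf_eq_prod_mul (hq : ‖q‖ < 1) (a : ℂ) (n : ℕ) :
    qInf a q = (∏ i ∈ range n, (1 - a * q ^ i)) * qInf (a * q ^ n) q := by
  have h := (multipliable_qInf hq (a * q ^ n))
  have h' : Multipliable fun i : ℕ => 1 - a * q ^ (i + n) := by
    refine h.congr fun i => ?_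
    rw [pow_add]; ring
  have := h'.prod_mul_tprod_nat_mul' (f := fun i : ℕ => 1 - a * q ^ i)
  rw [qInf, qInf, ← this]
  congr 1
  refine tprod_congr fun i => ?_
  rw [pow_add]; ring

theorem qInf_eq_one_sub_mul (hq : ‖q‖ < 1) (a : ℂ) :
    qInf a q = (1 - a) * qInf (a * q) q := by
  simpa using qInf_eq_prod_mul hq a 1

theorem qInf_ne_zero (hq : ‖q‖ < 1) {a : ℂ} (ha : ∀ i : ℕ, a * q ^ i ≠ 1) : qInf a q ≠ 0 := by
  have h : Summable fun i : ℕ => ‖-(a * q ^ i)‖ := by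
    simp only [norm_neg, norm_mul, norm_pow]
    exact (summable_geometric_of_lt_one (norm_nonneg _) hq).mul_left _
  have := tprod_one_add_ne_zero_of_summable (f := fun i : ℕ => -(a * q ^ i))
    (fun i => by rw [← sub_eq_add_neg]; exact sub_ne_zero.2 (ha i).symm) h
  simpa [qInf, sub_eq_add_neg] using this

theorem qInf_ne_zero_of_norm_lt_one (hq : ‖q‖ < 1) {a : ℂ} (ha : ‖a‖ < 1) : qInf a q ≠ 0 := by
  refine qInf_ne_zero hq fun i h => ?_
  have : ‖a * q ^ i‖ < 1 := by
    rw [norm_mul, norm_pow]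
    calc ‖a‖ * ‖q‖ ^ i ≤ ‖a‖ * 1 := by
          gcongr; exact pow_le_one₀ (norm_nonneg _) hq.le
      _ < 1 := by simpa using ha
  rw [h] at this
  simp at this

@[simp] theorem qInf_zero_left : qInf 0 q = 1 := by simp [qInf]

theorem tendsto_prod_qInf (hq : ‖q‖ < 1) (a : ℂ) :
    Tendsto (fun n : ℕ => ∏ i ∈ range n, (1 - a * q ^ i)) atTop (𝓝 (qInf a q)) :=
  (multipliable_qInf hq a).tendsto_prod_tprod_nat

theorem tendsto_qInf_mul_pow (hq : ‖q‖ < 1) (a : ℂ) :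
    Tendsto (fun n : ℕ => qInf (a * q ^ n) q) atTop (𝓝 1) := by
  have hlim : Tendsto (fun n : ℕ => a * q ^ n) atTop (𝓝 0) := by
    simpa using (tendsto_pow_atTop_nhds_zero_of_norm_lt_one hq).const_mul a
  -- Once ‖a q^m‖ < 1 the product is nonzero, and its tails are its quotients by partial products.
  obtain ⟨m, hm⟩ := ((hlim.norm.eventually_lt_const (by simp : ‖(0 : ℂ)‖ < 1))).exists
  have hne := qInf_ne_zero_of_norm_lt_one hq hm
  rw [← tendsto_add_atTop_iff_nat m]
  have h1 := (tendsto_const_nhds (x := qInf (a * q ^ m) q)).div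
    (tendsto_prod_qInf hq (a * q ^ m)) hne
  rw [div_self hne] at h1
  refine (h1.congr' ?_)
  have hev := (tendsto_prod_qInf hq (a * q ^ m)).eventually_ne hne
  filter_upwards [hev] with n hn
  rw [Pi.div_apply, div_eq_iff hn, qInf_eq_prod_mul hq _ n, mul_comm, pow_add]
  congr 2
  ring

/-! ### Reciprocal q-factorials and finite summations -/

/-- The reciprocal `1 / (q; q)_m`, extended by zero to negative `m`. -/
noncomputable def invFact (q : ℂ) (m : ℤ) : ℂ := qInf (q ^ (m + 1)) q / qInf q q

theorem qInf_self_ne_zero (hq : ‖q‖ < 1) : qInf q q ≠ 0 := qInf_ne_zero_of_norm_lt_one hq hq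

theorem pow_ne_one_of_norm (hq : ‖q‖ < 1) {n : ℕ} (hn : n ≠ 0) : q ^ n ≠ 1 := fun h => by
  have := pow_lt_one₀ (norm_nonneg q) hq hn
  rw [← norm_pow, h, norm_one] at this
  exact lt_irrefl _ this

theorem one_sub_mul_invFact (hq0 : q ≠ 0) (hq : ‖q‖ < 1) (m : ℤ) :
    (1 - q ^ m) * invFact q m = invFact q (m - 1) := by
  rw [invFact, invFact, sub_add_cancel, qInf_eq_one_sub_mul hq (q ^ m), zpow_add_one₀ hq0]
  ring

@[simp] theorem invFact_zero (hq : ‖q‖ < 1) : invFact q 0 = 1 := by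
  simp [invFact, div_self (qInf_self_ne_zero hq)]

theorem invFact_of_neg (hq0 : q ≠ 0) (hq : ‖q‖ < 1) {m : ℤ} (hm : m < 0) : invFact q m = 0 := by
  obtain ⟨n, rfl⟩ : ∃ n : ℕ, m = -(n + 1 : ℕ) := ⟨(-m - 1).toNat, by omega⟩
  rw [invFact, qInf_eq_prod_mul hq _ (n + 1), prod_eq_zero (i := n) (by simp)]
  · simp
  · rw [← zpow_natCast, ← zpow_add₀ hq0]
    simp

theorem invFact_natCast (hq : ‖q‖ < 1) (n : ℕ) :
    invFact q n = (∏ i ∈ range n, (1 - q ^ (i + 1)))⁻¹ := by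
  have h := qInf_eq_prod_mul hq q n
  have h0 := qInf_self_ne_zero hq
  refine eq_inv_of_mul_eq_one_left ?_
  rw [invFact, div_mul_eq_mul_div, div_eq_one_iff_eq h0]
  conv_rhs => rw [h]
  rw [mul_comm]
  congr 1
  · exact prod_congr rfl fun i _ => by ring
  · congr 1
    norm_cast
    ring

theorem tendsto_invFact (hq0 : q ≠ 0) (hq : ‖q‖ < 1) (j : ℤ) :
    Tendsto (fun n : ℕ => invFact q (n + j)) atTop (𝓝 (qInf q q)⁻¹) := by
  have := (tendsto_qInf_mul_pow hq (q ^ (j + 1))).div_const (qInf q q)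
  rw [one_div] at this
  refine this.congr fun n => ?_
  rw [invFact, ← zpow_natCast, ← zpow_add₀ hq0]
  congr 3
  ring

theorem exists_norm_invFact_le (hq0 : q ≠ 0) (hq : ‖q‖ < 1) :
    ∃ C : ℝ, 0 < C ∧ ∀ m : ℤ, ‖invFact q m‖ ≤ C := by
  have h := (tendsto_invFact hq0 hq 0).norm.bddAbove_range
  obtain ⟨C, hC⟩ := h
  refine ⟨max C 1, by positivity, fun m => ?_⟩
  rcases lt_or_ge m 0 with hm | hm
  · rw [invFact_of_neg hq0 hq hm]; simp
  · lift m to ℕ using hm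
    exact le_max_of_le_left (hC ⟨m, by simp⟩)

theorem exists_norm_qInf_le (hq : ‖q‖ < 1) (a : ℂ) :
    ∃ C : ℝ, 0 < C ∧ ∀ n : ℕ, ‖qInf (a * q ^ n) q‖ ≤ C := by
  obtain ⟨C, hC⟩ := (tendsto_qInf_mul_pow hq a).norm.bddAbove_range
  exact ⟨max C 1, by positivity, fun n => le_max_of_le_left (hC ⟨n, rfl⟩)⟩

theorem invFact_pascal (hq0 : q ≠ 0) (hq : ‖q‖ < 1) (s t : ℤ) :
    (1 - q ^ (s + t)) * (invFact q s * invFact q t) =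
      q ^ s * (invFact q s * invFact q (t - 1)) + invFact q (s - 1) * invFact q t := by
  rw [← one_sub_mul_invFact hq0 hq s, ← one_sub_mul_invFact hq0 hq t, zpow_add₀ hq0]
  ring

/-- The q-Pascal rule summed against f; the boundary terms vanish because `invFact` is zero at -1.
It drives the inductions for both summations below. -/
theorem one_sub_zpow_mul_sum (hq0 : q ≠ 0) (hq : ‖q‖ < 1) (N : ℕ) (f : ℕ → ℂ) :
    (1 - q ^ (N + 1)) * ∑ t ∈ range (N + 2), invFact q t * invFact q ((N + 1 : ℕ) - t) * f t =
      ∑ t ∈ range (N + 1), invFact q t * invFact q (N - t) * (q ^ t * f t + f (t + 1)) := by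
  have h : ∀ t : ℕ, (1 - q ^ (N + 1)) * (invFact q t * invFact q ((N + 1 : ℕ) - t) * f t) =
      invFact q t * invFact q (N - t) * (q ^ t * f t) +
        invFact q (t - 1) * invFact q ((N + 1 : ℕ) - t) * f t := fun t => by
    have := invFact_pascal hq0 hq t ((N + 1 : ℕ) - t)
    rw [show (t : ℤ) + ((N + 1 : ℕ) - t) = (N + 1 : ℕ) by ring,
      show ((N + 1 : ℕ) - t - 1 : ℤ) = N - t by push_cast; ring, zpow_natCast, zpow_natCast] at this
    linear_combination f t * this
  rw [mul_sum, sum_congr rfl fun t _ => h t, sum_add_distrib, sum_range_succ,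
    sum_range_succ' (fun t : ℕ => invFact q (t - 1) * invFact q ((N + 1 : ℕ) - t) * f t),
    invFact_of_neg hq0 hq (m := (N : ℤ) - (N + 1 : ℕ)) (by push_cast; omega),
    invFact_of_neg hq0 hq (m := ((0 : ℕ) : ℤ) - 1) (by simp)]
  simp only [mul_zero, zero_mul, add_zero]
  rw [← sum_add_distrib]
  refine sum_congr rfl fun t _ => ?_
  rw [show ((t + 1 : ℕ) : ℤ) - 1 = t by push_cast; ring,
    show ((N + 1 : ℕ) : ℤ) - (t + 1 : ℕ) = N - t by push_cast; ring]
  ring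

theorem invFact_succ (hq0 : q ≠ 0) (hq : ‖q‖ < 1) (N : ℕ) :
    (1 - q ^ (N + 1)) * invFact q (N + 1 : ℕ) = invFact q N := by
  have := one_sub_mul_invFact hq0 hq (N + 1 : ℕ)
  rw [zpow_natCast] at this
  rw [this]
  congr 1
  push_cast
  ring

theorem choose_two_succ (t : ℕ) : (t + 1).choose 2 = t.choose 2 + t := by
  rw [Nat.choose_succ_succ' t 1, Nat.choose_one_right, add_comm]

/-- A form of the `q`-Chu–Vandermonde summation. -/
theorem sum_qChuVandermonde (hq0 : q ≠ 0) (hq : ‖q‖ < 1) (y : ℂ) (N : ℕ) (c : ℂ) :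
    ∑ t ∈ range (N + 1), invFact q t * invFact q (N - t) *
      (q ^ t.choose 2 * c ^ t * (∏ i ∈ range t, (q ^ i - y)) *
        ∏ i ∈ range (N - t), (1 - c * q ^ (t + i))) =
    invFact q N * ∏ i ∈ range N, (1 - c * y * q ^ i) := by
  induction N generalizing c with
  | zero => simp [hq]
  | succ N ih =>
    have hne : (1 - q ^ (N + 1)) ≠ 0 :=
      sub_ne_zero.2 (pow_ne_one_of_norm hq (Nat.succ_ne_zero N)).symm
    apply mul_left_cancel₀ hne
    rw [one_sub_zpow_mul_sum hq0 hq N (fun t => q ^ t.choose 2 * c ^ t *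
      (∏ i ∈ range t, (q ^ i - y)) * ∏ i ∈ range (N + 1 - t), (1 - c * q ^ (t + i))),
      ← mul_assoc, invFact_succ hq0 hq, prod_range_succ']
    -- The two terms of the recurrence combine through (1 - c q^t) + c (q^t - y) = 1 - c y, leaving
    -- the summand at c q.
    have := ih (c * q)
    rw [show (∏ i ∈ range N, (1 - c * y * q ^ (i + 1))) = ∏ i ∈ range N, (1 - c * q * y * q ^ i)
      from prod_congr rfl fun i _ => by ring, ← mul_assoc, ← this, sum_mul]
    refine sum_congr rfl fun t ht => ?_
    have ht : t ≤ N := by simpa [Nat.lt_succ_iff] using ht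
    rw [show N + 1 - t = N - t + 1 by omega, show N + 1 - (t + 1) = N - t by omega,
      prod_range_succ', prod_range_succ, choose_two_succ,
      show (∏ i ∈ range (N - t), (1 - c * q ^ (t + (i + 1)))) =
        ∏ i ∈ range (N - t), (1 - c * q * q ^ (t + i)) from prod_congr rfl fun i _ => by ring,
      show (∏ i ∈ range (N - t), (1 - c * q ^ (t + 1 + i))) =
        ∏ i ∈ range (N - t), (1 - c * q * q ^ (t + i)) from prod_congr rfl fun i _ => by ring]
    ring

/-- The finite `q`-binomial theorem. -/
theorem sum_qBinomial (hq0 : q ≠ 0) (hq : ‖q‖ < 1) (N : ℕ) (z : ℂ) :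
    ∑ t ∈ range (N + 1), invFact q t * invFact q (N - t) *
      ((-1) ^ t * q ^ t.choose 2 * z ^ t) = invFact q N * ∏ i ∈ range N, (1 - z * q ^ i) := by
  induction N generalizing z with
  | zero => simp [hq]
  | succ N ih =>
    have hne : (1 - q ^ (N + 1)) ≠ 0 :=
      sub_ne_zero.2 (pow_ne_one_of_norm hq (Nat.succ_ne_zero N)).symm
    apply mul_left_cancel₀ hne
    rw [one_sub_zpow_mul_sum hq0 hq N (fun t => (-1) ^ t * q ^ t.choose 2 * z ^ t),
      ← mul_assoc, invFact_succ hq0 hq, prod_range_succ']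
    have := ih (z * q)
    rw [show (∏ i ∈ range N, (1 - z * q ^ (i + 1))) = ∏ i ∈ range N, (1 - z * q * q ^ i)
      from prod_congr rfl fun i _ => by ring, ← mul_assoc, ← this, sum_mul]
    refine sum_congr rfl fun t ht => ?_
    rw [choose_two_succ]
    ring

theorem invFact_eq_mul_prod (hq0 : q ≠ 0) (hq : ‖q‖ < 1) (m : ℤ) (M : ℕ) :
    invFact q m = invFact q (m + M) * ∏ i ∈ range M, (1 - q ^ (m + 1) * q ^ i) := by
  induction M with
  | zero => simp
  | succ M ih =>
    rw [ih, prod_range_succ, show m + (M : ℤ) = m + (M + 1 : ℕ) - 1 by push_cast; ring,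
      ← one_sub_mul_invFact hq0 hq, ← zpow_natCast q M, ← zpow_add₀ hq0,
      show m + 1 + (M : ℤ) = m + (M + 1 : ℕ) by push_cast; ring]
    ring

/-! ### Bailey kernels and the Bailey lemma -/

/-- The weight of one step along a Bailey chain. -/
noncomputable def weight (q z : ℂ) (e s : ℕ) : ℂ :=
  q ^ (s.choose 2 + (1 + e) * s) * ∏ i ∈ range s, (q ^ i - z)

theorem choose_two_add (j t : ℕ) : (j + t).choose 2 = j.choose 2 + t.choose 2 + j * t := by
  induction t with
  | zero => simp
  | succ t ih => rw [← add_assoc, choose_two_succ, ih, choose_two_succ]; ring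

theorem weight_add (hq0 : q ≠ 0) (z : ℂ) (e j t : ℕ) :
    weight q z e (j + t) = weight q z e j *
      (q ^ t.choose 2 * (q ^ (2 * j + 1 + e)) ^ t * ∏ i ∈ range t, (q ^ i - z / q ^ j)) := by
  have h : (q ^ j) ^ t * ∏ i ∈ range t, (q ^ i - z / q ^ j) =
      ∏ i ∈ range t, (q ^ (j + i) - z) := by
    rw [← card_range t, ← prod_const, card_range, ← prod_mul_distrib]
    refine prod_congr rfl fun i _ => ?_
    field_simp
    ring
  rw [weight, weight, prod_range_add, ← h, choose_two_add]
  ring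

/-- The kernel `1 / ((q; q)_{n-j} (q; q)_{n+e+j})`. -/
noncomputable def baileyKernel (q : ℂ) (e n : ℕ) (j : ℤ) : ℂ :=
  invFact q (n - j) * invFact q (n + e + j)

theorem baileyKernel_of_lt (hq0 : q ≠ 0) (hq : ‖q‖ < 1) {e n : ℕ} {j : ℤ} (h : n < j) :
    baileyKernel q e n j = 0 := by
  rw [baileyKernel, invFact_of_neg hq0 hq (by omega), zero_mul]

theorem baileyKernel_reflect (q : ℂ) (e n : ℕ) (j : ℤ) :
    baileyKernel q e n (-e - j) = baileyKernel q e n j := by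
  rw [baileyKernel, baileyKernel, mul_comm]
  congr 2 <;> ring

/-- The Bailey lemma for a single column j of the kernel. After s = j + t it is q-Chu–Vandermonde
with N = n - j, c = q^(2j+1+e), y = z/q^j. Using the tail product in n instead of dividing by (z
q^(1+e); q)_n avoids any condition on z. -/
theorem baileyKernel_step (hq0 : q ≠ 0) (hq : ‖q‖ < 1) (z : ℂ) (e n j : ℕ) :
    qInf (z * q ^ (1 + e) * q ^ n) q *
      ∑ s ∈ range (n + 1), invFact q (n - s) * weight q z e s * baileyKernel q e s j =
    weight q z e j * qInf (z * q ^ (1 + e) * q ^ j) q * baileyKernel q e n j := by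
  rcases lt_or_ge n j with hnj | hnj
  · rw [baileyKernel_of_lt hq0 hq (by exact_mod_cast hnj), mul_zero, sum_eq_zero, mul_zero]
    intro s hs
    rw [mem_range] at hs
    rw [baileyKernel_of_lt hq0 hq (by exact_mod_cast (by omega : s < j)), mul_zero]
  obtain ⟨N, rfl⟩ := Nat.exists_eq_add_of_le hnj
  rw [add_assoc j N 1, sum_range_add, sum_eq_zero (s := range j), zero_add]
  swap
  · intro s hs
    rw [mem_range] at hs
    rw [baileyKernel_of_lt hq0 hq (by exact_mod_cast hs), mul_zero]
  have key := sum_qChuVandermonde hq0 hq (z / q ^ j) N (q ^ (2 * j + 1 + e))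
  have hterm : ∀ t ∈ range (N + 1),
      invFact q ((j + N : ℕ) - (j + t : ℕ)) * weight q z e (j + t) *
        baileyKernel q e (j + t) j =
      weight q z e j * invFact q (2 * j + e + N) * (invFact q t * invFact q (N - t) *
        (q ^ t.choose 2 * (q ^ (2 * j + 1 + e)) ^ t * (∏ i ∈ range t, (q ^ i - z / q ^ j)) *
        ∏ i ∈ range (N - t), (1 - q ^ (2 * j + 1 + e) * q ^ (t + i)))) := by
    intro t ht
    have ht : t ≤ N := by simpa [Nat.lt_succ_iff] using ht
    have h := invFact_eq_mul_prod hq0 hq (2 * j + e + t) (N - t)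
    rw [show (2 * j + e + t : ℤ) + (N - t : ℕ) = 2 * j + e + N by omega,
      show ∏ i ∈ range (N - t), (1 - q ^ ((2 * j + e + t : ℤ) + 1) * q ^ i) =
        ∏ i ∈ range (N - t), (1 - q ^ (2 * j + 1 + e) * q ^ (t + i)) from
        prod_congr rfl fun i _ => by
          rw [show (2 * j + e + t : ℤ) + 1 = (2 * j + 1 + e + t : ℕ) by push_cast; ring,
            zpow_natCast]
          ring] at h
    rw [weight_add hq0, baileyKernel, show ((j + t : ℕ) : ℤ) - j = t by push_cast; ring,
      show ((j + t : ℕ) : ℤ) + e + j = 2 * j + e + t by push_cast; ring, h,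
      show ((j + N : ℕ) : ℤ) - (j + t : ℕ) = N - t by push_cast; ring]
    ring
  rw [sum_congr rfl hterm, ← mul_sum, key, qInf_eq_prod_mul hq (z * q ^ (1 + e) * q ^ j) N,
    baileyKernel, show ((j + N : ℕ) : ℤ) - j = N by push_cast; ring,
    show ((j + N : ℕ) : ℤ) + e + j = 2 * j + e + N by push_cast; ring,
    show ∏ i ∈ range N, (1 - q ^ (2 * j + 1 + e) * (z / q ^ j) * q ^ i) =
      ∏ i ∈ range N, (1 - z * q ^ (1 + e) * q ^ j * q ^ i) from prod_congr rfl fun i _ => by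
        field_simp
        ring,
    pow_add q j N, ← mul_assoc (z * q ^ (1 + e))]
  ring

theorem summable_mul_baileyKernel (hq0 : q ≠ 0) (hq : ‖q‖ < 1) (A : ℤ → ℂ) (e n : ℕ) :
    Summable fun j => A j * baileyKernel q e n j := by
  refine summable_of_ne_finset_zero (s := Icc (-(n + e : ℤ)) n) fun j hj => ?_
  rw [mem_Icc, not_and_or] at hj
  rcases hj with hj | hj
  · rw [baileyKernel, invFact_of_neg hq0 hq (m := n + e + j) (by omega), mul_zero, mul_zero]
  · rw [baileyKernel_of_lt hq0 hq (by omega), mul_zero]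

/-- The second half `β` of the Bailey pair whose first half is `A`, in two-sided form. -/
noncomputable def beta (q : ℂ) (e : ℕ) (A : ℤ → ℂ) (n : ℕ) : ℂ :=
  ∑' j, A j * baileyKernel q e n j

/-- By linearity, a relation for every column of the kernel passes to β; for fixed n the sums over j
have finite support. -/
theorem beta_step (hq0 : q ≠ 0) (hq : ‖q‖ < 1) {e n : ℕ} (A : ℤ → ℂ) {w : ℕ → ℂ} {κ : ℂ}
    {g : ℤ → ℂ} (h : ∀ j, κ * ∑ s ∈ range (n + 1), invFact q (n - s) * w s *
      baileyKernel q e s j = g j * baileyKernel q e n j) :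
    κ * ∑ s ∈ range (n + 1), invFact q (n - s) * w s * beta q e A s =
      beta q e (fun j => A j * g j) n := by
  simp only [beta, ← tsum_mul_left]
  have hsum : ∀ s ∈ range (n + 1), Summable fun j =>
      invFact q (n - s) * w s * (A j * baileyKernel q e s j) := fun s _ =>
    (summable_mul_baileyKernel hq0 hq A e s).mul_left _
  rw [← Summable.tsum_finsetSum hsum, ← tsum_mul_left]
  refine tsum_congr fun j => ?_
  rw [mul_assoc (A j), ← h j]
  simp only [mul_sum]
  exact sum_congr rfl fun s _ => by ring

theorem baileyKernel_natAbs (q : ℂ) (n : ℕ) (j : ℤ) :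
    baileyKernel q 0 n j = baileyKernel q 0 n j.natAbs := by
  rcases Int.natAbs_eq j with h | h
  · rw [← h]
  · have := baileyKernel_reflect q 0 n j.natAbs
    rw [← this]
    congr 1
    rw [Nat.cast_zero]
    omega

/-- The factor gained by `A` in a step with `e = 0`. -/
noncomputable def gain (q z : ℂ) (n : ℕ) : ℂ := weight q z 0 n * qInf (z * q ^ (1 + n)) q

theorem baileyKernel_step_zero (hq0 : q ≠ 0) (hq : ‖q‖ < 1) (z : ℂ) (n : ℕ) (j : ℤ) :
    qInf (z * q ^ (1 + n)) q *
      ∑ s ∈ range (n + 1), invFact q (n - s) * weight q z 0 s * baileyKernel q 0 s j =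
    gain q z j.natAbs * baileyKernel q 0 n j := by
  have := baileyKernel_step hq0 hq z 0 n j.natAbs
  simp only [← baileyKernel_natAbs] at this
  simpa [gain, pow_add, mul_assoc] using this

/-- The kernel with e = 1 is fixed by j ↦ -1 - j, so a multiplier with the same symmetry need only
be known for j ≥ 0. -/
theorem baileyKernel_step_one (hq0 : q ≠ 0) (hq : ‖q‖ < 1) (z : ℂ) (n : ℕ) (g : ℤ → ℂ)
    (hg : ∀ j : ℕ, g j = weight q z 1 j * qInf (z * q ^ 2 * q ^ j) q)
    (hg' : ∀ j, g (-1 - j) = g j) (j : ℤ) :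
    qInf (z * q ^ 2 * q ^ n) q *
      ∑ s ∈ range (n + 1), invFact q (n - s) * weight q z 1 s * baileyKernel q 1 s j =
    g j * baileyKernel q 1 n j := by
  rcases le_or_gt 0 j with h | h
  · lift j to ℕ using h
    rw [hg]
    exact baileyKernel_step hq0 hq z 1 n j
  · obtain ⟨m, hm⟩ : ∃ m : ℕ, -1 - j = m := ⟨(-1 - j).toNat, by omega⟩
    have hr : ∀ s : ℕ, baileyKernel q 1 s j = baileyKernel q 1 s m := fun s => by
      rw [← hm]
      exact (baileyKernel_reflect q 1 s j).symm
    simp only [hr]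
    rw [← hg', hm, hg]
    exact baileyKernel_step hq0 hq z 1 n m

theorem weight_zero_left (q : ℂ) (e s : ℕ) : weight q 0 e s = q ^ (s ^ 2 + e * s) := by
  have h : s.choose 2 + (1 + e) * s + s.choose 2 = s ^ 2 + e * s := by
    have := Nat.choose_two_right s
    have h2 := Nat.even_mul_pred_self s
    have : 2 * s.choose 2 = s * (s - 1) := by rw [this]; exact Nat.mul_div_cancel' h2.two_dvd
    cases s with
    | zero => simp
    | succ s => simp only [Nat.add_sub_cancel] at this; linarith
  simp only [weight, sub_zero]
  rw [prod_pow_eq_pow_sum, sum_range_id, ← Nat.choose_two_right, ← pow_add, h]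

/-- Tannery's theorem: the kernel is bounded and tends to 1/(q)_∞² for each j. -/
theorem tendsto_beta (hq0 : q ≠ 0) (hq : ‖q‖ < 1) (e : ℕ) {A : ℤ → ℂ} (hA : Summable A) :
    Tendsto (beta q e A) atTop (𝓝 ((∑' j, A j) * ((qInf q q)⁻¹ * (qInf q q)⁻¹))) := by
  obtain ⟨C, hC0, hC⟩ := exists_norm_invFact_le hq0 hq
  rw [← tsum_mul_right]
  refine tendsto_tsum_of_dominated_convergence (bound := fun j => ‖A j‖ * (C * C))
    (hA.norm.mul_right _) (fun j => ?_) (Eventually.of_forall fun n j => ?_)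
  · refine Tendsto.const_mul _ (Tendsto.mul ?_ ?_)
    · simpa [sub_eq_add_neg] using tendsto_invFact hq0 hq (-j)
    · simpa [add_assoc] using tendsto_invFact hq0 hq (e + j)
  · rw [norm_mul, baileyKernel, norm_mul]
    gcongr <;> apply hC

/-! ### Theta series and the Jacobi triple product -/

theorem two_mul_choose_two (n : ℕ) : (2 : ℤ) * (n.choose 2 : ℕ) = n * (n - 1) := by
  have : 2 * n.choose 2 = n * (n - 1) := by
    rw [Nat.choose_two_right]
    exact Nat.mul_div_cancel' (Nat.even_mul_pred_self n).two_dvd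
  cases n with
  | zero => simp
  | succ n => 
    simp only [Nat.add_sub_cancel] at this
    have h : (2 : ℤ) * ((n + 1).choose 2 : ℕ) = (n + 1) * n := by exact_mod_cast this
    rw [h]
    push_cast
    ring

theorem two_mul_half (j : ℤ) : 2 * (j * (j - 1) / 2) = j * (j - 1) :=
  Int.mul_ediv_cancel' (Int.even_mul_pred_self j).two_dvd

/-- The general term of the theta series `∑ (-1)^j z^j q^(j(j-1)/2)`. -/
noncomputable def thetaTerm (z q : ℂ) (j : ℤ) : ℂ := (-1) ^ j * z ^ j * q ^ (j * (j - 1) / 2)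

theorem thetaTerm_sub (hq0 : q ≠ 0) {z : ℂ} (hz : z ≠ 0) (L t : ℕ) :
    thetaTerm z q (t - L) = ((-1) ^ L * q ^ (-(L.choose 2 : ℤ)) * (z / q ^ L) ^ (-L : ℤ)) *
      ((-1) ^ t * q ^ t.choose 2 * (z / q ^ L) ^ t) := by
  have hexp : ((t : ℤ) - L) * (t - L - 1) / 2 =
      -(L.choose 2 : ℤ) + (t.choose 2 : ℤ) + L * L - L * t := by
    have h1 := two_mul_choose_two L
    have h2 := two_mul_choose_two t
    have h3 := two_mul_half ((t : ℤ) - L)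
    linarith
  have hs : (-1 : ℂ) ^ ((t : ℤ) - L) = (-1) ^ L * (-1) ^ t := by
    rw [sub_eq_add_neg, zpow_add₀ (by norm_num), zpow_natCast, zpow_neg, zpow_natCast, mul_comm]
    congr 1
    rcases neg_one_pow_eq_or ℂ L with h | h <;> rw [h] <;> norm_num
  have hzz : (z / q ^ L) ^ (-L : ℤ) * (z / q ^ L) ^ t =
      z ^ ((t : ℤ) - L) * q ^ ((L * L - L * t : ℤ)) := by
    rw [← zpow_natCast _ t, ← zpow_add₀ (div_ne_zero hz (pow_ne_zero _ hq0)), div_zpow,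
      ← zpow_natCast, ← zpow_mul, div_eq_mul_inv, ← zpow_neg, neg_add_eq_sub]
    congr 2
    ring
  rw [thetaTerm, hs, hexp, show -(L.choose 2 : ℤ) + (t.choose 2 : ℤ) + L * L - L * t =
    -(L.choose 2 : ℤ) + (t.choose 2 : ℤ) + (L * L - L * t) by ring, zpow_add₀ hq0, zpow_add₀ hq0,
    zpow_natCast]
  linear_combination -((-1) ^ L * (-1) ^ t * q ^ (-(L.choose 2 : ℤ)) * q ^ t.choose 2) * hzz

/-- With j = t - (n + e) this is the finite q-binomial theorem of degree 2n + e at z/q^(n+e). -/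
theorem beta_thetaTerm (hq0 : q ≠ 0) (hq : ‖q‖ < 1) {z : ℂ} (hz : z ≠ 0) (e n : ℕ) :
    beta q e (thetaTerm z q) n =
      ((-1) ^ (n + e) * q ^ (-((n + e).choose 2 : ℤ)) * (z / q ^ (n + e)) ^ (-(n + e : ℕ) : ℤ)) *
        (invFact q (2 * n + e : ℕ) *
          ∏ i ∈ range (2 * n + e), (1 - z / q ^ (n + e) * q ^ i)) := by
  have hinj : Function.Injective fun t : ℕ => (t : ℤ) - (n + e : ℕ) := fun a b h => by
    simpa using h
  rw [beta, ← hinj.tsum_eq]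
  · rw [tsum_eq_sum (s := range (2 * n + e + 1)), ← sum_qBinomial hq0 hq, mul_sum]
    · refine sum_congr rfl fun t _ => ?_
      rw [thetaTerm_sub hq0 hz, baileyKernel,
        show (n : ℤ) - (t - (n + e : ℕ)) = (2 * n + e : ℕ) - t by push_cast; ring,
        show (n : ℤ) + e + (t - (n + e : ℕ)) = t by push_cast; ring]
      ring
    · intro t ht
      rw [mem_range, not_lt] at ht
      rw [baileyKernel_of_lt hq0 hq (by push_cast; omega), mul_zero]
  · intro j hj
    rw [Function.mem_support] at hj
    refine ⟨(j + (n + e : ℕ)).toNat, ?_⟩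
    have : 0 ≤ n + e + j := by
      by_contra h
      exact hj (by rw [baileyKernel, invFact_of_neg hq0 hq (not_le.1 h), mul_zero, mul_zero])
    simp only
    push_cast
    omega

/-- The unit Bailey pair: for n ≥ 1 the product contains a factor 1 - q^0. -/
theorem beta_thetaTerm_one (hq0 : q ≠ 0) (hq : ‖q‖ < 1) (n : ℕ) :
    beta q 1 (thetaTerm 1 q) n = if n = 0 then 1 else 0 := by
  rw [beta_thetaTerm hq0 hq one_ne_zero]
  split_ifs with h
  · subst h
    have h1 := one_sub_mul_invFact hq0 hq 1
    rw [zpow_one, sub_self, invFact_zero hq] at h1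
    simp
    field_simp
    linear_combination h1
  · rw [prod_eq_zero (i := n + 1) (by rw [mem_range]; omega)]
    · simp
    · rw [div_mul_cancel₀ _ (pow_ne_zero _ hq0), sub_self]

theorem beta_thetaTerm_zero (hq0 : q ≠ 0) (hq : ‖q‖ < 1) {z : ℂ} (hz : z ≠ 0) (n : ℕ) :
    beta q 0 (thetaTerm z q) n = invFact q (2 * n : ℕ) *
      ((∏ i ∈ range n, (1 - z * q ^ i)) * ∏ i ∈ range n, (1 - q / z * q ^ i)) := by
  rw [beta_thetaTerm hq0 hq hz, add_zero, add_zero, two_mul, prod_range_add, mul_left_comm]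
  congr 1
  have h1 : ∏ i ∈ range n, (1 - z / q ^ n * q ^ (n + i)) = ∏ i ∈ range n, (1 - z * q ^ i) :=
    prod_congr rfl fun i _ => by rw [pow_add]; field_simp
  -- In reverse order the factors are 1 - z/q^(i+1) = -(z/q^(i+1)) (1 - (q/z) q^i); the extracted
  -- monomials cancel the prefactor from `beta_thetaTerm`.
  have h2 : ∏ i ∈ range n, (1 - z / q ^ n * q ^ i) =
      (-1) ^ n * q ^ n.choose 2 * (z / q ^ n) ^ n * ∏ i ∈ range n, (1 - q / z * q ^ i) := by
    rw [← prod_range_reflect (fun i => 1 - q / z * q ^ i), Nat.choose_two_right, ← sum_range_id,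
      ← prod_pow_eq_pow_sum]
    have : ∀ c : ℂ, c ^ n = ∏ i ∈ range n, c := fun c => by simp
    rw [this (-1), this (z / q ^ n), ← prod_mul_distrib, ← prod_mul_distrib, ← prod_mul_distrib]
    refine prod_congr rfl fun i hi => ?_
    rw [mem_range] at hi
    have : q ^ n = q * q ^ (n - 1 - i) * q ^ i := by
      rw [← pow_succ', ← pow_add]; congr 1; omega
    rw [this]
    field_simp
    ring
  rw [h1, h2, zpow_neg, zpow_neg, zpow_natCast, zpow_natCast]
  have h3 : ((-1 : ℂ) ^ n) * (-1) ^ n = 1 := by rw [← mul_pow]; simp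
  have hA : q ^ n.choose 2 ≠ 0 := pow_ne_zero _ hq0
  have hB : (z / q ^ n) ^ n ≠ 0 := pow_ne_zero _ (div_ne_zero hz (pow_ne_zero _ hq0))
  generalize q ^ n.choose 2 = A at *
  generalize (z / q ^ n) ^ n = B at *
  generalize ∏ i ∈ range n, (1 - z * q ^ i) = X
  generalize ∏ i ∈ range n, (1 - q / z * q ^ i) = Y
  field_simp
  linear_combination Y * X * h3

theorem summable_pow_mul_choose_two (hq0 : q ≠ 0) (hq : ‖q‖ < 1) {z : ℂ} (hz : z ≠ 0) :
    Summable fun n : ℕ => z ^ n * q ^ n.choose 2 := by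
  refine summable_of_ratio_test_tendsto_lt_one (l := 0) one_pos
    (Eventually.of_forall fun n => mul_ne_zero (pow_ne_zero _ hz) (pow_ne_zero _ hq0)) ?_
  have : Tendsto (fun n : ℕ => z * q ^ n) atTop (𝓝 0) := by
    simpa using (tendsto_pow_atTop_nhds_zero_of_norm_lt_one hq).const_mul z
  refine (by simpa using this.norm : Tendsto (fun n : ℕ => ‖z * q ^ n‖) atTop (𝓝 0)).congr
    fun n => ?_
  rw [← norm_div, choose_two_succ]
  congr 1
  field_simp
  ring

theorem summable_thetaTerm (hq0 : q ≠ 0) (hq : ‖q‖ < 1) {z : ℂ} (hz : z ≠ 0) :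
    Summable (thetaTerm z q) := by
  refine Summable.of_nat_of_neg ?_ ?_
  · refine (summable_pow_mul_choose_two hq0 hq hz).norm.of_norm_bounded fun n => ?_
    rw [thetaTerm, mul_assoc, norm_mul, norm_zpow, norm_neg, norm_one, one_zpow, one_mul,
      ← two_mul_choose_two, Int.mul_ediv_cancel_left _ two_ne_zero, zpow_natCast, zpow_natCast]
  · refine (summable_pow_mul_choose_two hq0 hq (div_ne_zero hq0 hz)).norm.of_norm_bounded
      fun n => ?_
    have : -(n : ℤ) * (-n - 1) / 2 = (n + n.choose 2 : ℕ) := by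
      have h1 := two_mul_half (-n)
      have h2 := two_mul_choose_two n
      push_cast
      linarith
    rw [thetaTerm, mul_assoc, norm_mul, norm_zpow, norm_neg, norm_one, one_zpow, one_mul, this,
      zpow_natCast, zpow_neg, zpow_natCast, pow_add, div_pow]
    apply le_of_eq
    congr 1
    ring

/-- The Jacobi triple product identity. -/
theorem hasSum_thetaTerm (hq0 : q ≠ 0) (hq : ‖q‖ < 1) {z : ℂ} (hz : z ≠ 0) :
    HasSum (thetaTerm z q) (qInf z q * qInf (q / z) q * qInf q q) := by
  have hs := summable_thetaTerm hq0 hq hz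
  have h1 := tendsto_beta hq0 hq 0 hs
  -- A second evaluation of the limit, from the closed form; equating it with `h1` gives the
  -- identity.
  have h2 : Tendsto (beta q 0 (thetaTerm z q)) atTop
      (𝓝 ((qInf q q)⁻¹ * (qInf z q * qInf (q / z) q))) := by
    rw [funext fun n => beta_thetaTerm_zero hq0 hq hz n]
    refine Tendsto.mul ?_ ((tendsto_prod_qInf hq z).mul (tendsto_prod_qInf hq _))
    have := (tendsto_invFact hq0 hq 0).comp (tendsto_id.const_mul_atTop' (two_pos (α := ℕ)))
    simpa [Function.comp_def] using this
  have h3 := tendsto_nhds_unique h1 h2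
  have h0 := qInf_self_ne_zero hq
  have h4 : ∑' j, thetaTerm z q j = qInf z q * qInf (q / z) q * qInf q q := by
    field_simp at h3
    linear_combination h3
  exact h4 ▸ hs.hasSum

/-! ### Multisums over chains -/

/-- A product of nearest-neighbour factors along `N`, times a factor of the last entry. -/
noncomputable def pathProd (K : ℕ → ℕ → ℕ → ℂ) (h : ℕ → ℂ) (m : ℕ) (N : Fin (m + 1) → ℕ) : ℂ :=
  (∏ i : Fin m, K i (N i.castSucc) (N i.succ)) * h (N (Fin.last m))

theorem pathProd_cons_cons (K : ℕ → ℕ → ℕ → ℂ) (h : ℕ → ℂ) (m n s : ℕ) (N : Fin m → ℕ) :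
    pathProd K h (m + 1) (Fin.cons n (Fin.cons s N)) =
      K 0 n s * pathProd (fun i => K (i + 1)) h m (Fin.cons s N) := by
  rw [pathProd, pathProd, Fin.prod_univ_succ, mul_assoc]
  congr 1

theorem tsum_pathProd (m : ℕ) (K : ℕ → ℕ → ℕ → ℂ) (f : ℕ → ℕ → ℂ)
    (hK : ∀ i n s, n < s → K i n s = 0)
    (hf : ∀ i < m, ∀ n, f i n = ∑ s ∈ range (n + 1), K i n s * f (i + 1) s) (n : ℕ)
    (hs : Summable fun N : Fin m → ℕ => pathProd K (f m) m (Fin.cons n N)) :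
    ∑' N : Fin m → ℕ, pathProd K (f m) m (Fin.cons n N) = f 0 n := by
  induction m generalizing K f n with
  | zero =>
    rw [tsum_eq_single default fun b hb => absurd (Subsingleton.elim _ _) hb]
    simp [pathProd]
  | succ m ih =>
    have hs' := (Fin.consEquiv fun _ : Fin (m + 1) => ℕ).summable_iff.2 hs
    simp only [Function.comp_def] at hs'
    rw [← (Fin.consEquiv fun _ : Fin (m + 1) => ℕ).tsum_eq, hs'.tsum_prod,
      hf 0 (Nat.succ_pos m) n]
    have key : ∀ s, ∑' N : Fin m → ℕ, pathProd K (f (m + 1)) (m + 1)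
        (Fin.cons n (Fin.cons s N)) = K 0 n s * f 1 s := fun s => by
      simp only [pathProd_cons_cons, tsum_mul_left]
      -- Summability of the inner family comes from a slice of the whole family divided by `K 0 n
      -- s`; if that factor is zero, both sides vanish.
      rcases eq_or_ne (K 0 n s) 0 with h0 | h0
      · simp [h0]
      · congr 1
        refine ih (fun i => K (i + 1)) (fun i => f (i + 1)) (fun i => hK (i + 1))
          (fun i hi => hf (i + 1) (by omega)) s ?_
        have := hs'.prod_factor s
        simp only [Fin.consEquiv, Equiv.coe_fn_mk, pathProd_cons_cons] at this
        exact (summable_mul_left_iff h0).1 this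
    simp only [Fin.consEquiv, Equiv.coe_fn_mk, key]
    refine tsum_eq_sum fun s hs => ?_
    rw [mem_range, not_lt] at hs
    rw [hK 0 n s (by omega), zero_mul]

theorem summable_prod_fin (m : ℕ) (b : ℕ → ℕ → ℝ) (hb : ∀ i, Summable (b i))
    (hb0 : ∀ i n, 0 ≤ b i n) : Summable fun N : Fin m → ℕ => ∏ i : Fin m, b i (N i) := by
  induction m generalizing b with
  | zero => exact (hasSum_fintype _).summable
  | succ m ih =>
    rw [← (Fin.consEquiv fun _ : Fin (m + 1) => ℕ).summable_iff]
    have := (hb 0).mul_of_nonneg (ih (fun i => b (i + 1)) (fun i => hb _) fun i => hb0 _)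
      (hb0 0) fun N => prod_nonneg fun i _ => hb0 _ _
    refine this.congr fun N => ?_
    simp [Fin.prod_univ_succ, Fin.consEquiv]

/-- Since K vanishes when n < s, the sum over chains is an unrestricted multisum, and the bounds `b`
dominate it by a product of one-variable series. -/
theorem hasSum_chain (m : ℕ) (K : ℕ → ℕ → ℕ → ℂ) (f : ℕ → ℕ → ℂ) (w : ℕ → ℂ)
    (hK : ∀ i n s, n < s → K i n s = 0)
    (hf : ∀ i < m, ∀ n, f i n = ∑ s ∈ range (n + 1), K i n s * f (i + 1) s)
    (b : ℕ → ℕ → ℝ) (hb : ∀ i, Summable (b i)) (hb0 : ∀ i n, 0 ≤ b i n)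
    (hw : ∀ n, ‖w n‖ ≤ b 0 n) (hKb : ∀ i < m, ∀ n s, ‖K i n s‖ ≤ b (i + 1) s)
    (C : ℝ) (hC : ∀ n, ‖f m n‖ ≤ C) :
    Summable (fun n => w n * f 0 n) ∧
    HasSum (fun N : Chain (m + 1) => w (N.1 0) * pathProd K (f m) m N.1)
      (∑' n, w n * f 0 n) := by
  have hbound : ∀ N : Fin (m + 1) → ℕ, ‖w (N 0) * pathProd K (f m) m N‖ ≤
      (∏ i : Fin (m + 1), b i (N i)) * C := fun N => by
    rw [pathProd, norm_mul, norm_mul, Fin.prod_univ_succ, norm_prod, ← mul_assoc]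
    have h1 : ∏ i : Fin m, ‖K i (N i.castSucc) (N i.succ)‖ ≤ ∏ i : Fin m, b (i + 1) (N i.succ) :=
      prod_le_prod (fun i _ => norm_nonneg _) fun i _ => hKb i i.2 _ _
    exact mul_le_mul (mul_le_mul (hw _) h1 (prod_nonneg fun i _ => norm_nonneg _) (hb0 _ _))
      (hC _) (norm_nonneg _) (mul_nonneg (hb0 _ _) (prod_nonneg fun i _ => hb0 _ _))
  have hs : Summable fun N : Fin (m + 1) → ℕ => w (N 0) * pathProd K (f m) m N :=
    ((summable_prod_fin (m + 1) b hb hb0).mul_right C).of_norm_bounded hbound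
  have hs' := (Fin.consEquiv fun _ : Fin (m + 1) => ℕ).summable_iff.2 hs
  simp only [Function.comp_def] at hs'
  have key : ∀ n, ∑' N : Fin m → ℕ, w n * pathProd K (f m) m (Fin.cons n N) = w n * f 0 n :=
    fun n => by
      rw [tsum_mul_left]
      rcases eq_or_ne (w n) 0 with h0 | h0
      · simp [h0]
      · congr 1
        refine tsum_pathProd m K f hK hf n ?_
        have := hs'.prod_factor n
        simp only [Fin.consEquiv, Equiv.coe_fn_mk] at this
        exact (summable_mul_left_iff h0).1 this
  have htsum : ∑' N : Fin (m + 1) → ℕ, w (N 0) * pathProd K (f m) m N = ∑' n, w n * f 0 n := by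
    rw [← (Fin.consEquiv fun _ : Fin (m + 1) => ℕ).tsum_eq, hs'.tsum_prod]
    exact tsum_congr key
  refine ⟨hs'.prod.congr key, ?_⟩
  have hsupp : Function.support (fun N : Fin (m + 1) → ℕ => w (N 0) * pathProd K (f m) m N) ⊆
      {N | Antitone N} := by
    intro N hN
    rw [Set.mem_ofPred_eq, Fin.antitone_iff_succ_le]
    intro i
    by_contra hlt
    refine hN ?_
    simp only [pathProd]
    rw [prod_eq_zero (mem_univ i) (hK _ _ _ (not_le.1 hlt)), zero_mul, mul_zero]
  exact (hasSum_subtype_iff_of_support_subset hsupp).2 (htsum ▸ hs.hasSum)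

/-! ### Weights, the starting pair, and the passage from e = 1 to e = 0 -/

theorem summable_weight (hq : ‖q‖ < 1) (z : ℂ) (e : ℕ) : Summable (weight q z e) := by
  refine summable_of_ratio_norm_eventually_le (r := 1 / 2) (by norm_num) ?_
  have h1 := tendsto_pow_atTop_nhds_zero_of_norm_lt_one hq
  have h2 : Tendsto (fun n : ℕ => q ^ n * (q ^ (1 + e) * (q ^ n - z))) atTop (𝓝 0) := by
    simpa using h1.mul ((h1.sub_const z).const_mul (q ^ (1 + e)))
  have h3 := h2.norm.eventually_lt_const (by simp : ‖(0 : ℂ)‖ < 1 / 2)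
  filter_upwards [h3] with n hn
  have : weight q z e (n + 1) = q ^ n * (q ^ (1 + e) * (q ^ n - z)) * weight q z e n := by
    rw [weight, weight, prod_range_succ, choose_two_succ]
    ring
  rw [this, norm_mul]
  gcongr

theorem qInf_neg_self_ne_zero (hq : ‖q‖ < 1) : qInf (-q) q ≠ 0 :=
  qInf_ne_zero_of_norm_lt_one hq (by rwa [norm_neg])

theorem prod_one_add_mul_qInf (hq : ‖q‖ < 1) (n : ℕ) :
    (∏ i ∈ range n, (1 + q ^ (i + 1))) * qInf (-q * q ^ n) q = qInf (-q) q := by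
  rw [qInf_eq_prod_mul hq (-q) n]
  congr 1
  exact prod_congr rfl fun i _ => by ring

theorem invFact_sq (hq : ‖q‖ < 1) (n : ℕ) :
    invFact (q ^ 2) n = invFact q n * (∏ i ∈ range n, (1 + q ^ (i + 1)))⁻¹ := by
  have hq2 : ‖q ^ 2‖ < 1 := by rw [norm_pow]; exact pow_lt_one₀ (norm_nonneg _) hq two_ne_zero
  rw [invFact_natCast hq2, invFact_natCast hq, ← mul_inv, ← prod_mul_distrib]
  congr 1
  exact prod_congr rfl fun i _ => by ring

/-- The step z = -1/q applied to the unit Bailey pair: only s = 0 survives in the sum, and the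
exponents add up to j(j-1)/2 + j(j+1)/2 = j². -/
theorem beta_sq (hq0 : q ≠ 0) (hq : ‖q‖ < 1) (n : ℕ) :
    beta q 1 (fun j => (-1) ^ j * q ^ (j ^ 2)) n = invFact (q ^ 2) n := by
  have hP := qInf_neg_self_ne_zero hq
  have hstep := beta_step hq0 hq (e := 1) (n := n) (thetaTerm 1 q)
    (baileyKernel_step_one hq0 hq (-q⁻¹) n (fun j => q ^ (j * (j - 1) / 2 + j) * qInf (-q) q)
      (fun j => by
        have h1 : -q⁻¹ * q ^ 2 = -q := by field_simp
        have h2 : weight q (-q⁻¹) 1 j = q ^ (j.choose 2 + j) *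
            ∏ i ∈ range j, (1 + q ^ (i + 1)) := by
          rw [weight, show j.choose 2 + (1 + 1) * j = j.choose 2 + j + j by ring, pow_add q _ j,
            mul_assoc]
          congr 1
          have : q ^ j = ∏ i ∈ range j, q := by simp
          rw [this, ← prod_mul_distrib]
          exact prod_congr rfl fun i _ => by field_simp; ring
        rw [h1, h2, mul_assoc, prod_one_add_mul_qInf hq, ← two_mul_choose_two,
          Int.mul_ediv_cancel_left _ two_ne_zero, ← Nat.cast_add, zpow_natCast])
      (fun j => by
        have h1 := two_mul_half j
        have h2 := two_mul_half (-1 - j)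
        congr 2
        linarith))
  simp only [beta_thetaTerm_one hq0 hq, mul_ite, mul_one, mul_zero] at hstep
  rw [sum_ite_eq' (range (n + 1)) 0, if_pos (by simp)] at hstep
  have hR : beta q 1 (fun j => thetaTerm 1 q j * (q ^ (j * (j - 1) / 2 + j) * qInf (-q) q)) n =
      beta q 1 (fun j => (-1) ^ j * q ^ (j ^ 2)) n * qInf (-q) q := by
    rw [beta, beta, ← tsum_mul_right]
    refine tsum_congr fun j => ?_
    have : j ^ 2 = j * (j - 1) / 2 + (j * (j - 1) / 2 + j) := by
      have := two_mul_half j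
      linarith
    rw [thetaTerm, one_zpow, this, zpow_add₀ hq0 (j * (j - 1) / 2) (j * (j - 1) / 2 + j)]
    ring
  rw [hR, show -q⁻¹ * q ^ 2 = -q by field_simp] at hstep
  have h3 := prod_one_add_mul_qInf hq n
  have h4 : ∏ i ∈ range n, (1 + q ^ (i + 1)) ≠ 0 := fun h => hP (by rw [← h3, h, zero_mul])
  rw [invFact_sq hq]
  apply mul_right_cancel₀ hP
  rw [← hstep]
  conv_rhs => rw [← h3]
  simp [weight]
  field_simp

/-- The termwise difference of the two sides is odd under j ↦ -1 - j, hence sums to zero. -/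
theorem one_add_mul_beta (hq0 : q ≠ 0) (hq : ‖q‖ < 1) {A : ℤ → ℂ}
    (hA : ∀ j, A (-1 - j) = -q ^ (2 * j + 1) * A j) (n : ℕ) :
    (1 + q ^ n) * beta q 1 A n = beta q 0 (fun j => A j * (1 + q ^ j)) n := by
  have h0 := (summable_mul_baileyKernel hq0 hq (fun j => A j * (1 + q ^ j)) 0 n)
  have h1 := (summable_mul_baileyKernel hq0 hq A 1 n).mul_left (1 + q ^ n)
  rw [beta, beta, ← tsum_mul_left, ← sub_eq_zero, ← h1.tsum_sub h0]
  set d : ℤ → ℂ := fun j => (1 + q ^ n) * (A j * baileyKernel q 1 n j) -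
    A j * (1 + q ^ j) * baileyKernel q 0 n j with hd
  have hform : ∀ j, d j = A j * baileyKernel q 1 n j *
      (q ^ n - q ^ j + q ^ ((n : ℤ) + 1 + j) * (1 + q ^ j)) := fun j => by
    have h : baileyKernel q 0 n j = (1 - q ^ ((n : ℤ) + 1 + j)) * baileyKernel q 1 n j := by
      have := one_sub_mul_invFact hq0 hq ((n : ℤ) + 1 + j)
      rw [baileyKernel, baileyKernel, Nat.cast_one, mul_left_comm, this]
      congr 2
      push_cast
      ring
    rw [hd]
    simp only [h]
    ring
  have hanti : ∀ j, d (-1 - j) = -d j := fun j => by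
    have hk : baileyKernel q 1 n (-1 - j) = baileyKernel q 1 n j := baileyKernel_reflect q 1 n j
    rw [hform, hform, hA, hk, show (n : ℤ) + 1 + (-1 - j) = n - j by ring,
      show 2 * j + 1 = j + j + 1 by ring]
    have hj := zpow_ne_zero j hq0
    simp only [zpow_add₀ hq0, zpow_sub₀ hq0, zpow_one, zpow_natCast, zpow_neg]
    field_simp
    ring
  have hsum : ∑' j, d j = -∑' j, d j := by
    conv_lhs => rw [← (Equiv.subLeft (-1 : ℤ)).tsum_eq]
    rw [← tsum_neg]
    exact tsum_congr hanti
  exact self_eq_neg.1 hsum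

/-! ### The Bailey chain of the theorem -/

section Chain

variable (q) (k r lam : ℕ) (x : ℕ → ℂ)

/-- The parameter `z` of the step at position `p`. -/
noncomputable def stepParam (p : ℕ) : ℂ :=
  if p ≤ lam then -(x p)⁻¹ else if p = lam + 1 then -1 else 0

/-- The full weight of the step at position `p`. -/
noncomputable def stepWeight (p s : ℕ) : ℂ :=
  (if p = lam + 1 then 1 / 2 else 1) * (if p = r then 1 + q ^ s else 1) *
    weight q (stepParam lam x p) (if p ≤ r then 0 else 1) s

/-- The transition kernel of the step at position `p`. -/
noncomputable def stepKernel (p n s : ℕ) : ℂ :=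
  qInf (stepParam lam x p * q ^ (1 + n)) q * invFact q (n - s) * stepWeight q r lam x p s

/-- The sequence `A` after the steps at positions `p, …, r`. -/
noncomputable def lowerSeq (p : ℕ) (j : ℤ) : ℂ :=
  (-1) ^ j * q ^ ((k - r) * j ^ 2 + (k - r - 1) * j) * (1 + q ^ j) *
    ∏ t ∈ Icc p r, (if t = lam + 1 then 1 / 2 else 1) * gain q (stepParam lam x t) j.natAbs

/-- The sequence `A` after the steps at positions `p, …, k - 1`, where `p > r`. -/
noncomputable def upperSeq (p : ℕ) (j : ℤ) : ℂ :=
  (-1) ^ j * q ^ ((k - p + 1) * j ^ 2 + (k - p) * j)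

/-- The sequences `β` along the Bailey chain. -/
noncomputable def chainBeta (p n : ℕ) : ℂ :=
  if p ≤ r then beta q 0 (lowerSeq q k r lam x p) n else beta q 1 (upperSeq q k p) n

end Chain

variable {k r lam : ℕ} {x : ℕ → ℂ}

theorem neg_one_zpow_neg_one_sub (j : ℤ) : (-1 : ℂ) ^ (-1 - j) = -(-1) ^ j := by
  rw [sub_eq_add_neg, zpow_add₀ (by norm_num), zpow_neg, zpow_neg]
  rcases Int.even_or_odd j with h | h
  · simp [h.neg_one_zpow]
  · simp [h.neg_one_zpow]

/-- Only p = r has content: there 1 + q^s trades e = 1 for e = 0. -/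
theorem chainBeta_succ (hq0 : q ≠ 0) (hq : ‖q‖ < 1) {p : ℕ} (hp : p ≤ r) (s : ℕ) :
    (if p = r then 1 + q ^ s else 1) * chainBeta q k r lam x (p + 1) s =
      beta q 0 (lowerSeq q k r lam x (p + 1)) s := by
  rcases hp.eq_or_lt with rfl | hlt
  · rw [if_pos rfl, chainBeta, if_neg (by omega), one_add_mul_beta hq0 hq]
    · congr 1
      funext j
      rw [upperSeq, lowerSeq, Icc_eq_empty (by omega), prod_empty, mul_one]
      push_cast
      ring_nf
    · intro j
      rw [upperSeq, upperSeq, neg_one_zpow_neg_one_sub]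
      have : ((k : ℤ) - (p + 1 : ℕ) + 1) * (-1 - j) ^ 2 + (k - (p + 1 : ℕ)) * (-1 - j) =
          (2 * j + 1) + ((k - (p + 1 : ℕ) + 1) * j ^ 2 + (k - (p + 1 : ℕ)) * j) := by ring
      rw [this, zpow_add₀ hq0 (2 * j + 1)]
      ring
  · rw [if_neg hlt.ne, one_mul, chainBeta, if_pos (by omega)]

theorem chainBeta_eq_sum (hq0 : q ≠ 0) (hq : ‖q‖ < 1) (hlr : lam < r) (p n : ℕ) :
    chainBeta q k r lam x p n =
      ∑ s ∈ range (n + 1), stepKernel q r lam x p n s * chainBeta q k r lam x (p + 1) s := by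
  rcases le_or_gt p r with hp | hp
  · have hsum : ∑ s ∈ range (n + 1), stepKernel q r lam x p n s * chainBeta q k r lam x (p + 1) s =
        (if p = lam + 1 then 1 / 2 else 1) * (qInf (stepParam lam x p * q ^ (1 + n)) q *
          ∑ s ∈ range (n + 1), invFact q (n - s) * weight q (stepParam lam x p) 0 s *
            beta q 0 (lowerSeq q k r lam x (p + 1)) s) := by
      rw [mul_sum, mul_sum]
      refine sum_congr rfl fun s _ => ?_
      rw [← chainBeta_succ hq0 hq hp, stepKernel, stepWeight]
      simp only [if_pos hp]
      ring
    rw [hsum, beta_step hq0 hq _ (baileyKernel_step_zero hq0 hq _ n), chainBeta, if_pos hp, beta,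
      beta, ← tsum_mul_left]
    refine tsum_congr fun j => ?_
    rw [lowerSeq, lowerSeq, ← insert_Icc_add_one_left_eq_Icc hp, prod_insert (by simp)]
    ring
  · have hz : stepParam lam x p = 0 := by
      rw [stepParam, if_neg (by omega), if_neg (by omega)]
    have hsum : ∑ s ∈ range (n + 1), stepKernel q r lam x p n s * chainBeta q k r lam x (p + 1) s =
        qInf (0 * q ^ 2 * q ^ n) q * ∑ s ∈ range (n + 1), invFact q (n - s) * weight q 0 1 s *
          beta q 1 (upperSeq q k (p + 1)) s := by
      rw [mul_sum]
      refine sum_congr rfl fun s _ => ?_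
      rw [stepKernel, stepWeight, hz, chainBeta, if_neg (by omega), if_neg (by omega),
        if_neg (by omega), if_neg (by omega)]
      simp
    have hg := baileyKernel_step_one hq0 hq 0 n (fun j => q ^ (j ^ 2 + j))
      (fun j => by
        rw [weight_zero_left]
        simp only [zero_mul, qInf_zero_left, mul_one, one_mul]
        exact_mod_cast rfl)
      (fun j => by
        congr 1
        ring)
    rw [hsum, beta_step hq0 hq _ hg, chainBeta, if_neg (by omega)]
    congr 1
    funext j
    rw [upperSeq, upperSeq, mul_assoc, ← zpow_add₀ hq0]
    congr 2
    push_cast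
    ring

theorem stepKernel_of_lt (hq0 : q ≠ 0) (hq : ‖q‖ < 1) {p n s : ℕ} (h : n < s) :
    stepKernel q r lam x p n s = 0 := by
  rw [stepKernel, invFact_of_neg hq0 hq (by omega), mul_zero, zero_mul]

theorem norm_stepWeight_le (hq : ‖q‖ < 1) (p s : ℕ) :
    ‖stepWeight q r lam x p s‖ ≤
      2 * ‖weight q (stepParam lam x p) (if p ≤ r then 0 else 1) s‖ := by
  rw [stepWeight, norm_mul, norm_mul]
  have h1 : ‖(if p = lam + 1 then 1 / 2 else 1 : ℂ)‖ ≤ 1 := by split_ifs <;> norm_num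
  have h2 : ‖(if p = r then 1 + q ^ s else 1 : ℂ)‖ ≤ 2 := by
    split_ifs
    · refine (norm_add_le _ _).trans ?_
      rw [norm_one, norm_pow]
      linarith [pow_le_one₀ (norm_nonneg q) hq.le (n := s)]
    · norm_num
  gcongr
  nlinarith [norm_nonneg (if p = r then 1 + q ^ s else 1 : ℂ)]

/-- The sum over the unbounded N_1 is the limit n → ∞ of the Bailey step at position 1. That limit
is ∑ A_j / (q)_∞² on the side of A and the multisum over (q)_∞ on the other; one factor (q)_∞
cancels. -/
theorem hasSum_stepKernel (hq0 : q ≠ 0) (hq : ‖q‖ < 1) (hlr : lam < r) {m : ℕ} (hrk : r < m + 2)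
    (hA : Summable (lowerSeq q (m + 2) r lam x 1)) :
    HasSum (fun N : Chain (m + 1) => stepWeight q r lam x 1 (N.1 0) *
      pathProd (fun i => stepKernel q r lam x (i + 2)) (fun n => invFact (q ^ 2) n) m N.1)
      ((∑' j, lowerSeq q (m + 2) r lam x 1 j) / qInf q q) := by
  obtain ⟨C, hC0, hC⟩ := exists_norm_invFact_le hq0 hq
  have hq2 : ‖q ^ 2‖ < 1 := by rw [norm_pow]; exact pow_lt_one₀ (norm_nonneg _) hq two_ne_zero
  obtain ⟨C', hC0', hC'⟩ := exists_norm_invFact_le (pow_ne_zero 2 hq0) hq2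
  choose D hD0 hD using fun p => exists_norm_qInf_le hq (stepParam lam x p * q)
  have hlast : chainBeta q (m + 2) r lam x (m + 2) = fun n : ℕ => invFact (q ^ 2) n := by
    funext n
    rw [chainBeta, if_neg (by omega), ← beta_sq hq0 hq]
    congr 1
    funext j
    simp [upperSeq]
  have main := hasSum_chain m (fun i => stepKernel q r lam x (i + 2))
    (fun i => chainBeta q (m + 2) r lam x (i + 2)) (stepWeight q r lam x 1)
    (fun i n s h => stepKernel_of_lt hq0 hq h)
    (fun i _ n => chainBeta_eq_sum hq0 hq hlr (i + 2) n)
    -- Index i bounds position i + 1. The 1 serves the outermost weight, which carries no kernel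
    -- factor; D C bounds that factor at the other positions.
    (fun i s => (1 + D (i + 1) * C) *
      (2 * ‖weight q (stepParam lam x (i + 1)) (if i + 1 ≤ r then 0 else 1) s‖))
    (fun i => ((summable_weight hq _ _).norm.mul_left 2).mul_left _)
    (fun i n => by have := hD0 (i + 1); positivity)
    (fun n => by
      refine (norm_stepWeight_le hq 1 n).trans (le_mul_of_one_le_left (by positivity) ?_)
      have := hD0 1
      simp only [zero_add, le_add_iff_nonneg_right]
      positivity)
    (fun i _ n s => by
      have := hD0 (i + 1 + 1)
      rw [stepKernel, norm_mul, norm_mul]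
      refine mul_le_mul ?_ (norm_stepWeight_le hq (i + 2) s) (norm_nonneg _) (by positivity)
      have h1 : ‖qInf (stepParam lam x (i + 2) * q ^ (1 + n)) q‖ ≤ D (i + 2) := by
        have := hD (i + 2) n
        rwa [mul_assoc, ← pow_succ', add_comm n] at this
      have := mul_le_mul h1 (hC (n - s)) (norm_nonneg _) (hD0 _).le
      linarith)
    C' (fun n => by
      simp only [hlast]
      exact hC' n)
  obtain ⟨hs, hsum⟩ := main
  simp only [hlast] at hsum
  convert hsum using 1
  simp only [zero_add] at hs ⊢
  have hlim1 := tendsto_beta hq0 hq 0 hA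
  have hlim2 : Tendsto (beta q 0 (lowerSeq q (m + 2) r lam x 1)) atTop
      (𝓝 (1 * ∑' s, (qInf q q)⁻¹ *
        (stepWeight q r lam x 1 s * chainBeta q (m + 2) r lam x 2 s))) := by
    have hform : ∀ n, beta q 0 (lowerSeq q (m + 2) r lam x 1) n =
        qInf (stepParam lam x 1 * q * q ^ n) q * ∑' s : ℕ, invFact q (n - s) *
          (stepWeight q r lam x 1 s * chainBeta q (m + 2) r lam x 2 s) := fun n => by
      have := chainBeta_eq_sum (k := m + 2) (x := x) hq0 hq hlr 1 n
      rw [chainBeta, if_pos (by omega)] at this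
      rw [this, tsum_eq_sum (s := range (n + 1)), mul_sum]
      · refine sum_congr rfl fun s _ => ?_
        rw [stepKernel, pow_add, pow_one]
        ring_nf
      · intro s hs
        rw [mem_range, not_lt] at hs
        rw [invFact_of_neg hq0 hq (by omega), zero_mul]
    rw [funext hform]
    refine (tendsto_qInf_mul_pow hq _).mul ?_
    refine tendsto_tsum_of_dominated_convergence (hs.norm.mul_left C) (fun s => ?_)
      (Eventually.of_forall fun n s => ?_)
    · refine Tendsto.mul_const _ ?_
      simpa [sub_eq_add_neg] using tendsto_invFact hq0 hq (-s)
    · rw [norm_mul]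
      gcongr
      exact hC _
  have h := tendsto_nhds_unique hlim1 hlim2
  rw [one_mul, tsum_mul_left] at h
  have h0 := qInf_self_ne_zero hq
  field_simp at h
  field_simp
  linear_combination h

/-! ### Evaluation of the final sequence A -/

/-- Since (1 + q^n) ∏_{i<n} (1 + q^i) = 2 ∏_{i=1}^n (1 + q^i), the 1/2 cancels and the tail
completes to (-q; q)_∞. Negative j reduces to this by 1 + q^(-n) = q^(-n) (1 + q^n). -/
theorem half_one_add_mul_gain (hq0 : q ≠ 0) (hq : ‖q‖ < 1) (j : ℤ) :
    1 / 2 * (1 + q ^ j) * gain q (-1) j.natAbs = q ^ (j * (j - 1) / 2 + j) * qInf (-q) q := by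
  have h (n : ℕ) : (1 + q ^ n) * gain q (-1) n = 2 * q ^ (n.choose 2 + n) * qInf (-q) q := by
    have h1 : (∏ i ∈ range n, (q ^ i - -1)) * (1 + q ^ n) =
        2 * ∏ i ∈ range n, (1 + q ^ (i + 1)) := by
      have e1 := prod_range_succ (fun i => 1 + q ^ i) n
      rw [prod_range_succ', pow_zero, one_add_one_eq_two] at e1
      rw [mul_comm (2 : ℂ), e1]
      congr 1
      exact prod_congr rfl fun i _ => by ring
    rw [gain, weight, ← prod_one_add_mul_qInf hq n, pow_add q 1 n, pow_one, ← mul_assoc (-1 : ℂ),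
      neg_one_mul, add_zero, one_mul]
    linear_combination (q ^ (n.choose 2 + n) * qInf (-q * q ^ n) q) * h1
  have h3 := two_mul_choose_two j.natAbs
  have h4 := two_mul_half j
  rcases Int.natAbs_eq j with hj | hj
  · generalize j.natAbs = n at *
    subst hj
    have := h n
    rw [show (n : ℤ) * (n - 1) / 2 + n = (n.choose 2 + n : ℕ) by push_cast; linarith,
      zpow_natCast, zpow_natCast]
    linear_combination 1 / 2 * this
  · generalize j.natAbs = n at *
    subst hj
    have := h n
    rw [show -(n : ℤ) * (-n - 1) / 2 + -n = (n.choose 2 : ℕ) by linarith,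
      zpow_natCast, zpow_neg, zpow_natCast]
    have hn : q ^ n ≠ 0 := pow_ne_zero _ hq0
    rw [pow_add] at this
    field_simp
    linear_combination this

theorem prod_Icc_reflect (lam : ℕ) (f : ℕ → ℂ) :
    ∏ t ∈ Icc 1 lam, f (lam + 1 - t) = ∏ t ∈ Icc 1 lam, f t := by
  refine prod_nbij' (fun t => lam + 1 - t) (fun t => lam + 1 - t) ?_ ?_ ?_ ?_ ?_
  all_goals intro t ht; simp only [mem_Icc] at ht ⊢
  all_goals omega

/-- Because q/x_t = x_(lam+1-t), the tail at t starts at -x_(lam+1-t) q^n. Reflecting the index of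
the tails attaches each to the finite product with the same x, which completes the infinite product.
-/
theorem prod_gain (hq : ‖q‖ < 1) {lam : ℕ} {x : ℕ → ℂ}
    (hx : ∀ t ∈ Icc 1 lam, x t ≠ 0) (hxq : ∀ t ∈ Icc 1 lam, x t * x (lam + 1 - t) = q) (n : ℕ) :
    ∏ t ∈ Icc 1 lam, gain q (-(x t)⁻¹) n =
      (q ^ (n.choose 2 + n)) ^ lam * ((∏ t ∈ Icc 1 lam, x t) ^ n)⁻¹ *
        ∏ t ∈ Icc 1 lam, qInf (-x t) q := by
  have h1 : ∀ t ∈ Icc 1 lam, gain q (-(x t)⁻¹) n =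
      q ^ (n.choose 2 + n) * (x t ^ n)⁻¹ *
        ((∏ i ∈ range n, (1 - -x t * q ^ i)) * qInf (-x (lam + 1 - t) * q ^ n) q) := by
    intro t ht
    have h0 := hx t ht
    have h2 : -(x t)⁻¹ * q ^ (1 + n) = -x (lam + 1 - t) * q ^ n := by
      rw [pow_add, pow_one, ← hxq t ht]
      field_simp
    have h3 : ∏ i ∈ range n, (q ^ i - -(x t)⁻¹) =
        (x t ^ n)⁻¹ * ∏ i ∈ range n, (1 - -x t * q ^ i) := by
      have : (x t ^ n)⁻¹ = ∏ i ∈ range n, (x t)⁻¹ := by simp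
      rw [this, ← prod_mul_distrib]
      exact prod_congr rfl fun i _ => by field_simp; ring
    rw [gain, weight, h2, h3, add_zero, one_mul]
    ring
  rw [prod_congr rfl h1, prod_mul_distrib, prod_mul_distrib, prod_mul_distrib, prod_const,
    Nat.card_Icc, Nat.add_sub_cancel, prod_inv_distrib, prod_pow,
    prod_Icc_reflect lam (fun t => qInf (-x t * q ^ n) q), ← prod_mul_distrib]
  congr 1
  exact prod_congr rfl fun t _ => (qInf_eq_prod_mul hq _ n).symm

theorem lowerSeq_one (hq0 : q ≠ 0) (hq : ‖q‖ < 1) {k r lam : ℕ} (hlr : lam < r) {x : ℕ → ℂ}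
    (hx : ∀ t ∈ Icc 1 lam, x t ≠ 0) (hxq : ∀ t ∈ Icc 1 lam, x t * x (lam + 1 - t) = q) (j : ℤ) :
    lowerSeq q k r lam x 1 j =
      (qInf (-q) q * ∏ t ∈ Icc 1 lam, qInf (-x t) q) *
      ((-1) ^ j * q ^ ((k - lam - 1) * j ^ 2 + (k - r - 1) * j + (j * (j - 1) / 2 + j) +
        (j.natAbs.choose 2 + j.natAbs) * lam) * ((∏ t ∈ Icc 1 lam, x t) ^ j.natAbs)⁻¹) := by
  have hsplit : Icc 1 r = Icc 1 lam ∪ insert (lam + 1) (Icc (lam + 2) r) := by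
    ext t
    simp only [mem_union, mem_insert, mem_Icc]
    omega
  have hdisj : Disjoint (Icc 1 lam) (insert (lam + 1) (Icc (lam + 2) r)) := by
    rw [disjoint_left]
    intro t
    simp only [mem_insert, mem_Icc]
    omega
  have hlow : ∀ t ∈ Icc 1 lam, (if t = lam + 1 then 1 / 2 else 1) *
      gain q (stepParam lam x t) j.natAbs = gain q (-(x t)⁻¹) j.natAbs := fun t ht => by
    rw [mem_Icc] at ht
    rw [if_neg (by omega), one_mul, stepParam, if_pos ht.2]
  have hhigh : ∀ t ∈ Icc (lam + 2) r, (if t = lam + 1 then 1 / 2 else 1) *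
      gain q (stepParam lam x t) j.natAbs = q ^ (j ^ 2) := fun t ht => by
    rw [mem_Icc] at ht
    rw [if_neg (by omega), one_mul, stepParam, if_neg (by omega), if_neg (by omega), gain,
      weight_zero_left, zero_mul, zero_mul, qInf_zero_left, mul_one, add_zero, ← Int.natAbs_sq,
      ← zpow_natCast]
    push_cast
    rfl
  rw [lowerSeq, hsplit, prod_union hdisj, prod_congr rfl hlow, prod_insert (by simp),
    prod_congr rfl hhigh, prod_const, Nat.card_Icc, prod_gain hq hx hxq, if_pos rfl, stepParam,
    if_neg (by omega), if_pos rfl]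
  have hg := half_one_add_mul_gain hq0 hq j
  have hexp : (k - lam - 1 : ℤ) * j ^ 2 + (k - r - 1) * j + (j * (j - 1) / 2 + j) +
      (j.natAbs.choose 2 + j.natAbs) * lam =
      ((k - r) * j ^ 2 + (k - r - 1) * j) + j ^ 2 * (r + 1 - (lam + 2) : ℕ) +
      (j * (j - 1) / 2 + j) + (j.natAbs.choose 2 + j.natAbs : ℕ) * (lam : ℕ) := by
    rw [Nat.cast_sub (by omega)]
    push_cast
    ring
  have hpow : ∀ a b c d : ℤ, q ^ (a + b + c + d) = q ^ a * q ^ b * q ^ c * q ^ d :=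
    fun a b c d => by rw [zpow_add₀ hq0, zpow_add₀ hq0, zpow_add₀ hq0]
  rw [hexp, hpow, zpow_mul q (j ^ 2), zpow_mul q (j.natAbs.choose 2 + j.natAbs : ℕ), zpow_natCast,
    zpow_natCast, zpow_natCast]
  linear_combination ((-1) ^ j * q ^ (((k : ℤ) - r) * j ^ 2 + (k - r - 1) * j) *
    (q ^ (j.natAbs.choose 2 + j.natAbs)) ^ lam * ((∏ t ∈ Icc 1 lam, x t) ^ j.natAbs)⁻¹ *
    (∏ t ∈ Icc 1 lam, qInf (-x t) q) * (q ^ j ^ 2) ^ (r + 1 - (lam + 2))) * hg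

/-- The symmetry gives ∑ α_t = lam η / 2, so η lam |j|(|j|+1)/2 - |j| ∑ α_t = η lam j²/2: the
absolute values disappear and the exponent is a quadratic polynomial in j. -/
theorem lowerSeq_one_eq_thetaTerm (hq0 : q ≠ 0) (hq : ‖q‖ < 1) {k r lam : ℕ} (hlr : lam < r)
    {η : ℤ} (hη : 0 < η) {α : ℕ → ℤ}
    (hsymm : ∀ i ∈ Set.Icc 1 lam, α i = η - α (lam + 1 - i)) (j : ℤ) :
    lowerSeq (q ^ η) k r lam (fun t => q ^ α t) 1 j =
      (qInf (-q ^ η) (q ^ η) * ∏ t ∈ Icc 1 lam, qInf (-q ^ α t) (q ^ η)) *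
      thetaTerm (q ^ ((4 * k - 2 * r - lam - 2) * η / 2)) (q ^ ((2 * k - lam - 1) * η)) j := by
  have hQ0 : q ^ η ≠ 0 := zpow_ne_zero _ hq0
  have hQ : ‖q ^ η‖ < 1 := by
    lift η to ℕ using hη.le
    rw [zpow_natCast, norm_pow]
    exact pow_lt_one₀ (norm_nonneg _) hq (by omega)
  rw [lowerSeq_one hQ0 hQ hlr (fun t _ => zpow_ne_zero _ hq0)
    (fun t ht => by
      rw [← zpow_add₀ hq0, hsymm t (by simpa using ht)]
      congr 1
      ring)]
  congr 1
  have hsum : 2 * ∑ t ∈ Icc 1 lam, α t = lam * η := by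
    have h1 : ∑ t ∈ Icc 1 lam, α (lam + 1 - t) = ∑ t ∈ Icc 1 lam, α t := by
      refine sum_nbij' (fun t => lam + 1 - t) (fun t => lam + 1 - t) ?_ ?_ ?_ ?_ ?_
      all_goals intro t ht; simp only [mem_Icc] at ht ⊢
      all_goals omega
    have h2 : ∑ t ∈ Icc 1 lam, α t = ∑ t ∈ Icc 1 lam, (η - α (lam + 1 - t)) :=
      sum_congr rfl fun t ht => hsymm t (by simpa using ht)
    rw [sum_sub_distrib, h1, sum_const, Nat.card_Icc] at h2
    simp at h2
    linarith
  have hprod : ∏ t ∈ Icc 1 lam, q ^ α t = q ^ ∑ t ∈ Icc 1 lam, α t := by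
    induction (Icc 1 lam) using Finset.induction_on with
    | empty => simp
    | insert a s ha ih => rw [prod_insert ha, sum_insert ha, ih, zpow_add₀ hq0]
  rw [hprod, thetaTerm, mul_assoc, mul_assoc, ← zpow_natCast, ← zpow_mul, ← zpow_neg, ← zpow_mul,
    ← zpow_mul, ← zpow_mul, ← zpow_add₀ hq0, ← zpow_add₀ hq0]
  congr 2
  have h1 := two_mul_choose_two j.natAbs
  have h2 := two_mul_half j
  have h3 := Int.mul_ediv_cancel' (two_dvd_exponents k r lam η α hsymm).2
  have h4 : (j.natAbs : ℤ) ^ 2 = j ^ 2 := Int.natAbs_sq j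
  generalize (∑ t ∈ Icc 1 lam, α t) = S at *
  generalize ((4 * k - 2 * r - lam - 2) * η / 2) = Z at *
  generalize (j * (j - 1) / 2) = c at *
  generalize ((j.natAbs.choose 2 : ℕ) : ℤ) = d at *
  generalize (j.natAbs : ℤ) = n at *
  have : 2 * (η * ((k - lam - 1) * j ^ 2 + (k - r - 1) * j + (c + j) + (d + n) * lam) + -(S * n)) =
      2 * (Z * j + (2 * k - lam - 1) * η * c) := by
    linear_combination (η - (2 * k - lam - 1) * η) * h2 + η * lam * h1 - n * hsum - j * h3
      + η * lam * h4
  linarith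

/-! ### Matching the summand with the step weights -/

/-- Of the s² powers of q, s(s-1)/2 are spent on q^i (1 - z q^(-i)) = q^i - z for i < s. -/
theorem qInf_mul_zpow_one_sub (hq0 : q ≠ 0) (hq : ‖q‖ < 1) (z : ℂ) (s : ℕ) :
    q ^ s ^ 2 * qInf (z * q ^ (1 - s : ℤ)) q = weight q z 0 s * qInf (z * q) q := by
  rw [qInf_eq_prod_mul hq (z * q ^ (1 - s : ℤ)) s, weight, mul_assoc z, ← zpow_natCast q s,
    ← zpow_add₀ hq0, sub_add_cancel, zpow_one, ← mul_assoc]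
  congr 1
  have h : s ^ 2 = s.choose 2 + (1 + 0) * s + s.choose 2 := by
    have := two_mul_choose_two s
    zify
    linarith
  rw [h, pow_add q _ (s.choose 2), mul_assoc]
  congr 1
  rw [← prod_range_reflect, Nat.choose_two_right, ← sum_range_id, ← prod_pow_eq_pow_sum,
    ← prod_mul_distrib]
  refine prod_congr rfl fun i hi => ?_
  rw [mem_range] at hi
  have : q ^ i * (z * q ^ (1 - s : ℤ) * q ^ (s - 1 - i)) = z := by
    have h0 : q ^ (i : ℤ) * q ^ (1 - s : ℤ) * q ^ ((s - 1 - i : ℕ) : ℤ) = 1 := by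
      rw [← zpow_add₀ hq0, ← zpow_add₀ hq0, show (i : ℤ) + (1 - s) + (s - 1 - i : ℕ) = 0 by omega,
        zpow_zero]
    rw [zpow_natCast, zpow_natCast] at h0
    linear_combination z * h0
  linear_combination -this

theorem qFin_self (hq0 : q ≠ 0) (d : ℤ) : qFin q q d = (invFact q d)⁻¹ := by
  rw [qFin, invFact, inv_div, zpow_add_one₀ hq0, mul_comm q]

/-- The 1/2 comes from the denominator (-1; q)_∞ = 2 (-q; q)_∞; this includes s = 0, where the index
is -1. -/
theorem pow_sq_mul_qFin_neg_one (hq0 : q ≠ 0) (hq : ‖q‖ < 1) (s : ℕ) :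
    q ^ s ^ 2 * qFin (-q ^ (1 - s : ℤ)) q (s - 1) = 1 / 2 * weight q (-1) 0 s := by
  have h1 := qInf_mul_zpow_one_sub hq0 hq (-1) s
  have h2 := qInf_eq_one_sub_mul hq (-1)
  have h3 := qInf_neg_self_ne_zero hq
  rw [neg_one_mul] at h1 h2
  rw [qFin, neg_mul, ← zpow_add₀ hq0, show (1 - s : ℤ) + (s - 1) = 0 by ring, zpow_zero,
    ← mul_div_assoc, h1, h2, neg_one_mul]
  field_simp
  norm_num

theorem pow_sq_mul_qFin (hq0 : q ≠ 0) (hq : ‖q‖ < 1) {z : ℂ} (hz : ‖z * q‖ < 1) (s : ℕ) :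
    q ^ s ^ 2 * qFin (z * q ^ (1 - s : ℤ)) q s = weight q z 0 s := by
  rw [qFin, mul_assoc z, ← zpow_add₀ hq0, sub_add_cancel, zpow_one, ← mul_div_assoc,
    qInf_mul_zpow_one_sub hq0 hq,
    mul_div_cancel_right₀ _ (qInf_ne_zero_of_norm_lt_one hq hz)]

theorem norm_zpow_lt_one (hq : ‖q‖ < 1) {n : ℤ} (hn : 0 < n) : ‖q ^ n‖ < 1 := by
  lift n to ℕ using hn.le
  rw [zpow_natCast, norm_pow]
  exact pow_lt_one₀ (norm_nonneg _) hq (by omega)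

theorem stepWeight_eq (hq0 : q ≠ 0) (hq : ‖q‖ < 1) {r lam : ℕ} (hlr : lam < r) {η : ℤ}
    (hη : 0 < η) {α : ℕ → ℤ} {p : ℕ} (hα : p ≤ lam → α p < η) (s : ℕ) :
    stepWeight (q ^ η) r lam (fun t => q ^ α t) p s =
      (q ^ η) ^ s ^ 2 * (if r ≤ p then (q ^ η) ^ s else 1) *
        (if p = r then 1 + q ^ (-(η * s)) else 1) *
        (if p = lam + 1 then qFin (-q ^ (η - η * s)) (q ^ η) (s - 1) else 1) *
        (if p ≤ lam then qFin (-q ^ (η - α p - η * s)) (q ^ η) s else 1) := by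
  have hQ0 : q ^ η ≠ 0 := zpow_ne_zero _ hq0
  have hQ := norm_zpow_lt_one hq hη
  -- At p = r the linear exponent turns the factor 1 + q^(-η s) of the summand into the 1 + q^(η s)
  -- of the chain.
  have hfold : (q ^ η) ^ s * (1 + q ^ (-(η * s))) = 1 + (q ^ η) ^ s := by
    have : (q ^ η) ^ s * q ^ (-(η * s)) = 1 := by
      rw [← zpow_natCast, ← zpow_mul, ← zpow_add₀ hq0, add_neg_cancel, zpow_zero]
    rw [mul_add, this]
    ring
  rw [stepWeight, stepParam]
  rcases le_or_gt p lam with h1 | h1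
  · have hz : ‖-(q ^ α p)⁻¹ * q ^ η‖ < 1 := by
      rw [neg_mul, norm_neg, ← zpow_neg, ← zpow_add₀ hq0]
      exact norm_zpow_lt_one hq (by have := hα h1; omega)
    rw [if_neg (by omega), if_neg (by omega), if_pos h1, if_pos (by omega), if_neg (by omega),
      if_neg (by omega), if_neg (by omega), if_pos h1, ← pow_sq_mul_qFin hQ0 hQ hz]
    have : -(q ^ α p)⁻¹ * (q ^ η) ^ (1 - s : ℤ) = -q ^ (η - α p - η * s) := by
      rw [neg_mul, ← zpow_neg, ← zpow_mul, ← zpow_add₀ hq0]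
      congr 2
      ring
    rw [this]
    ring
  · simp only [if_neg h1.not_ge]
    have hhalf := pow_sq_mul_qFin_neg_one hQ0 hQ s
    rw [← zpow_mul, show η * (1 - s : ℤ) = η - η * s by ring] at hhalf
    have hw0 : weight (q ^ η) 0 0 s = (q ^ η) ^ s ^ 2 := by simp [weight_zero_left]
    have hw1 : weight (q ^ η) 0 1 s = (q ^ η) ^ s ^ 2 * (q ^ η) ^ s := by
      rw [weight_zero_left, one_mul, pow_add]
    rcases eq_or_ne p (lam + 1) with h2 | h2
    · simp only [if_pos h2]
      rcases (by omega : p < r ∨ p = r) with h3 | h3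
      · rw [if_neg (by omega), if_pos (by omega), if_neg (by omega), if_neg (by omega)]
        linear_combination -hhalf
      · simp only [if_pos h3, if_pos h3.le, if_pos h3.ge]
        linear_combination -((1 + (q ^ η) ^ s) * hhalf) - (q ^ η) ^ s ^ 2 *
          qFin (-q ^ (η - η * s)) (q ^ η) (s - 1) * hfold
    · simp only [if_neg h2]
      rcases lt_trichotomy p r with h3 | h3 | h3
      · rw [if_neg (by omega), if_pos (by omega), if_neg (by omega), if_neg (by omega), hw0]
        ring
      · simp only [if_pos h3, if_pos h3.le, if_pos h3.ge]
        rw [hw0]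
        linear_combination -(q ^ η) ^ s ^ 2 * hfold
      · rw [if_neg (by omega), if_neg (by omega), if_pos (by omega), if_neg (by omega), hw1]
        ring

theorem prod_Icc_ite_le {m lam : ℕ} (h : lam ≤ m) (a : ℕ) (f : ℕ → ℂ) :
    ∏ p ∈ Icc a m, (if p ≤ lam then f p else 1) = ∏ p ∈ Icc a lam, f p := by
  rw [← prod_filter]
  congr 1
  ext p
  simp only [mem_filter, mem_Icc]
  omega

theorem prod_Icc_ite_ge {m r : ℕ} (h : 1 ≤ r) (f : ℕ → ℂ) :
    ∏ p ∈ Icc 1 m, (if r ≤ p then f p else 1) = ∏ p ∈ Icc r m, f p := by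
  rw [← prod_filter]
  congr 1
  ext p
  simp only [mem_filter, mem_Icc]
  omega

theorem prod_Icc_ite_eq {m r : ℕ} (h : 1 ≤ r) (hm : r ≤ m) (f : ℕ → ℂ) :
    ∏ p ∈ Icc 1 m, (if p = r then f p else 1) = f r := by
  rw [prod_ite_eq', if_pos (by simp [h, hm])]

/-- The summand, for an arbitrary sequence of entries, in terms of the weights of the steps. -/
theorem prod_stepWeight (hq0 : q ≠ 0) (hq : ‖q‖ < 1) {m r lam : ℕ} (hlr : lam < r) (hrm : r ≤ m)
    {η : ℤ} (hη : 0 < η) {α : ℕ → ℤ} (hα : ∀ p ∈ Set.Icc 1 lam, α p < η) (a : ℕ → ℕ) :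
    ∏ p ∈ Icc 1 m, stepWeight (q ^ η) r lam (fun t => q ^ α t) p (a p) =
      q ^ (η * (∑ i ∈ Icc 1 m, (a i : ℤ) ^ 2 + ∑ i ∈ Icc r m, (a i : ℤ))) *
        (1 + q ^ (-(η * a r))) *
        qFin (-q ^ (η - η * a (lam + 1))) (q ^ η) (a (lam + 1) - 1) *
        ∏ s ∈ Icc 1 lam, qFin (-q ^ (η - α s - η * a s)) (q ^ η) (a s) := by
  have h1 : ∀ p ∈ Icc 1 m, _ := fun p hp => stepWeight_eq hq0 hq hlr hη
    (fun h => hα p ⟨(mem_Icc.1 hp).1, h⟩) (a p)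
  rw [prod_congr rfl h1]
  simp only [prod_mul_distrib]
  rw [prod_Icc_ite_ge (by omega) fun p => (q ^ η) ^ a p,
    prod_Icc_ite_eq (by omega) hrm fun p => 1 + q ^ (-(η * a p)),
    prod_Icc_ite_eq (by omega) (by omega)
      fun p => qFin (-q ^ (η - η * a p)) (q ^ η) (a p - 1),
    prod_Icc_ite_le (by omega) 1 fun p => qFin (-q ^ (η - α p - η * a p)) (q ^ η) (a p),
    prod_pow_eq_pow_sum, prod_pow_eq_pow_sum, ← pow_add, ← zpow_natCast, ← zpow_mul]
  push_cast
  rfl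

/-- The tail at position p involves N_(p-1), and the one at p = 1 has tended to 1, so the product
starts at p = 2. For lam = 0 the position lam + 1 of the parameter -1 is p = 1 itself, whence the
`if`. -/
theorem prod_qInf_stepParam (hq0 : q ≠ 0) {m lam : ℕ} (hlm : lam < m)
    {η : ℤ} {α : ℕ → ℤ} (a : ℕ → ℕ) :
    ∏ p ∈ Icc 2 m, qInf (stepParam lam (fun t => q ^ α t) p * (q ^ η) ^ (1 + a (p - 1))) (q ^ η) =
      (if lam = 0 then 1 else qInf (-q ^ (η + η * a lam)) (q ^ η)) *
        ∏ s ∈ Icc 2 lam, qInf (-q ^ (η - α s + η * a (s - 1))) (q ^ η) := by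
  have h : ∀ p ∈ Icc 2 m,
      qInf (stepParam lam (fun t => q ^ α t) p * (q ^ η) ^ (1 + a (p - 1))) (q ^ η) =
      (if p = lam + 1 then qInf (-q ^ (η + η * a (p - 1))) (q ^ η) else 1) *
      (if p ≤ lam then qInf (-q ^ (η - α p + η * a (p - 1))) (q ^ η) else 1) := by
    intro p _
    have hpow : (q ^ η) ^ (1 + a (p - 1)) = q ^ (η + η * a (p - 1)) := by
      rw [← zpow_natCast, ← zpow_mul]
      congr 1
      push_cast
      ring
    rw [stepParam, hpow]
    split_ifs with h1 h2 h3
    · omega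
    · rw [one_mul, neg_mul, ← zpow_neg, ← zpow_add₀ hq0]
      congr 3
      ring
    · rw [neg_one_mul, mul_one]
    · simp
  rw [prod_congr rfl h, prod_mul_distrib,
    prod_Icc_ite_le hlm.le 2 fun p => qInf (-q ^ (η - α p + η * a (p - 1))) (q ^ η), prod_ite_eq']
  congr 1
  rcases Nat.eq_zero_or_pos lam with h0 | h0
  · rw [if_pos h0, if_neg (by rw [mem_Icc]; omega)]
  · rw [if_neg h0.ne', if_pos (by rw [mem_Icc]; omega), Nat.add_sub_cancel]

theorem prod_range_eq_prod_Icc (m : ℕ) {c : ℕ} (hc : 1 ≤ c) (f : ℕ → ℂ) :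
    ∏ i ∈ range m, f (i + c) = ∏ p ∈ Icc c (m + c - 1), f p := by
  refine prod_nbij' (fun i => i + c) (fun p => p - c) ?_ ?_ ?_ ?_ ?_
  all_goals intro t ht; simp only [mem_Icc, mem_range, Nat.add_sub_cancel] at ht ⊢
  all_goals omega

theorem term_eq (hq0 : q ≠ 0) (hq : ‖q‖ < 1) {m r lam : ℕ} (hlr : lam < r) (hrm : r ≤ m + 1)
    {η : ℤ} (hη : 0 < η) {α : ℕ → ℤ} (hα : ∀ p ∈ Set.Icc 1 lam, α p < η) (N : Chain (m + 1)) :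
    term (m + 2) r lam η α q N =
      stepWeight (q ^ η) r lam (fun t => q ^ α t) 1 (N.1 0) *
        pathProd (fun i => stepKernel (q ^ η) r lam (fun t => q ^ α t) (i + 2))
          (fun n => invFact ((q ^ η) ^ 2) n) m N.1 := by
  have hQ0 : q ^ η ≠ 0 := zpow_ne_zero _ hq0
  -- The chain reindexed from 1 and extended to ℕ; only the entries 1, …, m + 1 matter.
  obtain ⟨a, ha⟩ : ∃ a : ℕ → ℕ, ∀ i : Fin (m + 1), N.1 i = a (i + 1) :=
    ⟨fun p => if h : p - 1 < m + 1 then N.1 ⟨p - 1, h⟩ else 0, fun i => by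
      simp only [Nat.add_sub_cancel]
      rw [dif_pos i.2]⟩
  have hpart : ∀ p ∈ Icc 1 (m + 1), N.part p = a p := fun p hp => by
    rw [mem_Icc] at hp
    rw [Chain.part, dif_pos hp, ha]
    simp only
    congr 2
    omega
  have hfin : ∏ i : Fin m, stepKernel (q ^ η) r lam (fun t => q ^ α t) (i + 2) (N.1 i.castSucc)
      (N.1 i.succ) = ∏ i ∈ range m, stepKernel (q ^ η) r lam (fun t => q ^ α t) (i + 2)
        (a (i + 1)) (a (i + 2)) := by
    rw [← Fin.prod_univ_eq_prod_range (fun i => stepKernel (q ^ η) r lam (fun t => q ^ α t) (i + 2)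
      (a (i + 1)) (a (i + 2)))]
    exact prod_congr rfl fun i _ => by rw [ha, ha]; simp
  have hV := prod_qInf_stepParam hq0 (m := m + 1) (lam := lam) (by omega) (η := η) (α := α) a
  have hW := prod_stepWeight hq0 hq hlr hrm hη hα a
  have hWr := prod_range_eq_prod_Icc (m + 1) le_rfl
    fun p => stepWeight (q ^ η) r lam (fun t => q ^ α t) p (a p)
  rw [prod_range_succ', Nat.add_sub_cancel, hW] at hWr
  have hVr := prod_range_eq_prod_Icc m one_le_two
    fun p => qInf (stepParam lam (fun t => q ^ α t) p * (q ^ η) ^ (1 + a (p - 1))) (q ^ η)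
  rw [show m + 2 - 1 = m + 1 by omega, hV] at hVr
  have hUr := prod_range_eq_prod_Icc m le_rfl fun p => invFact (q ^ η) (a p - a (p + 1))
  rw [Nat.add_sub_cancel] at hUr
  rw [pathProd, hfin, ha, ha]
  simp only [stepKernel, prod_mul_distrib]
  simp only [Fin.val_zero, Fin.val_last, zero_add, add_assoc, Nat.reduceAdd] at hWr hVr hUr ⊢
  simp only [show ∀ i : ℕ, i + 2 - 1 = i + 1 from fun i => rfl] at hVr
  rw [hVr, hUr]
  have e1 : ∑ i ∈ Icc 1 (m + 1), N.part i ^ 2 = ∑ i ∈ Icc 1 (m + 1), (a i : ℤ) ^ 2 :=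
    sum_congr rfl fun i hi => by rw [hpart i hi]
  have e2 : ∑ i ∈ Icc r (m + 1), N.part i = ∑ i ∈ Icc r (m + 1), (a i : ℤ) :=
    sum_congr rfl fun i hi => hpart i (by rw [mem_Icc] at hi ⊢; omega)
  have e3 : ∏ i ∈ Icc 1 m, qFin (q ^ η) (q ^ η) (N.part i - N.part (i + 1)) =
      (∏ i ∈ Icc 1 m, invFact (q ^ η) (a i - a (i + 1)))⁻¹ := by
    rw [← prod_inv_distrib]
    refine prod_congr rfl fun i hi => ?_
    rw [mem_Icc] at hi
    rw [qFin_self hQ0, hpart i (by rw [mem_Icc]; omega), hpart (i + 1) (by rw [mem_Icc]; omega)]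
  have e4 : ∏ s ∈ Icc 1 lam, qFin (-q ^ (η - α s - η * N.part s)) (q ^ η) (N.part s) =
      ∏ s ∈ Icc 1 lam, qFin (-q ^ (η - α s - η * a s)) (q ^ η) (a s) :=
    prod_congr rfl fun s hs => by rw [hpart s (by rw [mem_Icc] at hs ⊢; omega)]
  have e5 : ∏ s ∈ Icc 2 lam, qInf (-q ^ (η - α s + η * N.part (s - 1))) (q ^ η) =
      ∏ s ∈ Icc 2 lam, qInf (-q ^ (η - α s + η * a (s - 1))) (q ^ η) :=
    prod_congr rfl fun s hs => by rw [hpart (s - 1) (by rw [mem_Icc] at hs ⊢; omega)]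
  have e6 : (if lam = 0 then 1 else qInf (-q ^ (η + η * N.part lam)) (q ^ η)) =
      (if lam = 0 then 1 else qInf (-q ^ (η + η * a lam)) (q ^ η)) := by
    split_ifs with h
    · rfl
    · rw [hpart lam (by rw [mem_Icc]; omega)]
  have e7 : qFin (q ^ (2 * η)) (q ^ (2 * η)) (N.part (m + 1)) =
      (invFact ((q ^ η) ^ 2) (a (m + 1)))⁻¹ := by
    rw [hpart (m + 1) (by simp), mul_comm 2 η, zpow_mul, zpow_ofNat, qFin_self (pow_ne_zero 2 hQ0)]
  rw [term]
  simp only [show m + 2 - 1 = m + 1 from rfl, show m + 2 - 2 = m from rfl]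
  rw [e1, e2, e3, e4, e5, e6, e7, hpart r (by rw [mem_Icc]; omega),
    hpart (lam + 1) (by rw [mem_Icc]; omega), ← mul_inv, div_inv_eq_mul]
  linear_combination -(((if lam = 0 then 1 else qInf (-q ^ (η + η * a lam)) (q ^ η)) *
    ∏ s ∈ Icc 2 lam, qInf (-q ^ (η - α s + η * a (s - 1))) (q ^ η)) *
    (∏ i ∈ Icc 1 m, invFact (q ^ η) (a i - a (i + 1))) * invFact ((q ^ η) ^ 2) (a (m + 1))) * hWr

/-! ### Conclusion -/

theorem hasSum_term (hq0 : q ≠ 0) (hq1 : ‖q‖ < 1) {k r lam : ℕ} (hlr : lam < r) (hrk : r < k)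
    {η : ℤ} (hη : 0 < η) {α : ℕ → ℤ} (hα : ∀ i ∈ Set.Icc 1 lam, α i < η)
    (hsymm : ∀ i ∈ Set.Icc 1 lam, α i = η - α (lam + 1 - i)) :
    HasSum (fun N : Chain (k - 1) => term k r lam η α q N) (productSide k r lam η α q) := by
  obtain ⟨m, rfl⟩ : ∃ m, k = m + 2 := ⟨k - 2, by omega⟩
  have hQ0 : q ^ η ≠ 0 := zpow_ne_zero _ hq0
  have hQ := norm_zpow_lt_one hq1 hη
  have hM : 0 < (2 * ((m + 2 : ℕ) : ℤ) - lam - 1) * η := mul_pos (by push_cast; omega) hη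
  have hlow := funext (lowerSeq_one_eq_thetaTerm (k := m + 2) hq0 hq1 hlr hη hsymm)
  have htheta := hasSum_thetaTerm (zpow_ne_zero _ hq0) (norm_zpow_lt_one hq1 hM)
    (z := q ^ ((4 * ((m + 2 : ℕ) : ℤ) - 2 * r - lam - 2) * η / 2)) (zpow_ne_zero _ hq0)
  have hA := htheta.mul_left
    (qInf (-q ^ η) (q ^ η) * ∏ t ∈ Finset.Icc 1 lam, qInf (-q ^ α t) (q ^ η))
  rw [← hlow] at hA
  have main := hasSum_stepKernel hQ0 hQ hlr hrk hA.summable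
  rw [hA.tsum_eq] at main
  -- The companion parameter q/z of the triple product is the other exponent of the product side.
  have hdiv : q ^ ((2 * ((m + 2 : ℕ) : ℤ) - lam - 1) * η) /
      q ^ ((4 * ((m + 2 : ℕ) : ℤ) - 2 * r - lam - 2) * η / 2) = q ^ ((2 * r - lam) * η / 2) := by
    rw [← zpow_sub₀ hq0]
    congr 1
    have h1 := Int.mul_ediv_cancel' (two_dvd_exponents (m + 2) r lam η α hsymm).1
    have h2 := Int.mul_ediv_cancel' (two_dvd_exponents (m + 2) r lam η α hsymm).2
    have : 2 * ((2 * ((m + 2 : ℕ) : ℤ) - lam - 1) * η -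
      (4 * ((m + 2 : ℕ) : ℤ) - 2 * r - lam - 2) * η / 2) = 2 * ((2 * r - lam) * η / 2) := by
      linear_combination -h1 - h2
    linarith
  rw [hdiv] at main
  rw [← funext fun N => term_eq hq0 hq1 hlr (by omega) hη hα N] at main
  have hside : productSide (m + 2) r lam η α q =
      (qInf (-q ^ η) (q ^ η) * ∏ t ∈ Icc 1 lam, qInf (-q ^ α t) (q ^ η)) *
        (qInf (q ^ ((4 * ((m + 2 : ℕ) : ℤ) - 2 * r - lam - 2) * η / 2))
            (q ^ ((2 * ((m + 2 : ℕ) : ℤ) - lam - 1) * η)) *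
          qInf (q ^ ((2 * r - lam) * η / 2)) (q ^ ((2 * ((m + 2 : ℕ) : ℤ) - lam - 1) * η)) *
          qInf (q ^ ((2 * ((m + 2 : ℕ) : ℤ) - lam - 1) * η))
            (q ^ ((2 * ((m + 2 : ℕ) : ℤ) - lam - 1) * η))) / qInf (q ^ η) (q ^ η) := by
    rw [productSide]
    ring
  rw [hside]
  exact main

end OverBressoud

theorem theorem1p11 (k r lam : ℕ) (hlr : lam < r) (hrk : r < k)
    (η : ℤ) (hη : 0 < η) (α : ℕ → ℤ)
    (hpos : ∀ i ∈ Set.Icc 1 lam, 0 < α i ∧ α i < η)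
    (hmono : StrictMonoOn α (Set.Icc 1 lam))
    (hsymm : ∀ i ∈ Set.Icc 1 lam, α i = η - α (lam + 1 - i))
    (q : ℂ) (hq0 : q ≠ 0) (hq1 : ‖q‖ < 1) :
    HasSum (fun N : OverBressoud.Chain (k - 1) => OverBressoud.term k r lam η α q N)
      (OverBressoud.productSide k r lam η α q) := by
  exact OverBressoud.hasSum_term hq0 hq1 hlr hrk hη (fun i hi => (hpos i hi).2) hsymm
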